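/- **Setting.** Let $(X,d,\mu)$ be a bounded (non-empty) metric measure space, i.e. $(X,d)$ is a bounded metric space and $\mu$ is a Borel measure with $0<\mu(B(x,r))<\infty$ for all $x\in X$, $r>0$. Let $\mathcal P(X)$ be the set of measurable $q:X\to(0,\infty]$ with $\operatorname{ess\,inf} q>0$, and let $\mathcal P_b^{\log}(X)$ be the set of essentially bounded $p\in\mathcal P(X)$ such that, for some $C>0$, $|1/p(x)-1/p(y)|\le C/\log(e+1/d(x,y))$ for all $x,y\in X$. Write $f\ll g$ (or $g\gg f$) if $\operatorname{ess\,inf}(g-f)>0$. Assume that there are $Q\in\mathcal P_b^{\log}(X)$, $\delta\in(0,\infty)$, $b\in(0,1]$ with $\mu(B(x,r))\ge b\,r^{Q(x)}$ for all $x\in X$ and $r\in(0,\delta]$, and let $p,s\in\mathcal P_b^{\log}(X)$ and $q\in\mathcal P(X)$. **Norms** (with $\inf\emptyset=\infty$). Let $\rho_{p(\cdot)}(f)=\int_X|f|^{p(x)}\,d\mu$ and $\|f\|_{L^{p(\cdot)}}=\inf\{\lambda>0:\rho_{p(\cdot)}(f/\lambda)\le1\}$, with $f\in L^{p(\cdot)}$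 iff $f$ is measurable and $\rho_{p(\cdot)}(f)<\infty$. For sequences $g=\{g_k\}_{k\in\mathbb Z}$ of measurable functions let $\|g\|_{L^{p(\cdot)}(\ell^{q(\cdot)})}=\big\|\,\|\{g_k(x)\}_k\|_{\ell^{q(x)}}\big\|_{L^{p(\cdot)}}$, with $g\in L^{p(\cdot)}(\ell^{q(\cdot)})$ iff $\|\{g_k(x)\}_k\|_{\ell^{q(x)}}\in L^{p(\cdot)}$. Let $\rho(g)=\sum_{k}\inf\{\lambda>0:\rho_{p(\cdot)}(g_k/\lambda^{1/q(\cdot)})\le1\}$ (with $\lambda^{1/\infty}=1$) and $\|g\|_{\ell^{q(\cdot)}(L^{p(\cdot)})}=\inf\{\lambda>0:\rho(g/\lambda)\le1\}$, with $g\in\ell^{q(\cdot)}(L^{p(\cdot)})$ iff all $g_k\in L^{p(\cdot)}$ and $\rho(g/\lambda)<\infty$ for some $\lambda>0$. **Spaces.** For a measurable, a.e. finite $u:X\to[-\infty,\infty]$ let $\mathbb D^{s(\cdot)}(u)$ be the set of sequences $g=\{g_k\}_{k\in\mathbb Z}$ of measurable $g_k:X\to[0,\infty]$ for which there is a null set $N$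 such that $$|u(x)-u(y)|\le d(x,y)^{s(x)}g_k(x)+d(x,y)^{s(y)}g_k(y)$$ for all $k\in\mathbb Z$ and $x,y\in X\setminus N$ with $2^{-k-1}\le d(x,y)<2^{-k}$. The space $\dot M^{s(\cdot)}_{p(\cdot),q(\cdot)}$ (resp. $\dot N^{s(\cdot)}_{p(\cdot),q(\cdot)}$) consists of all such $u$ with $\inf_{g\in\mathbb D^{s(\cdot)}(u)}\|g\|<\infty$, where $\|\cdot\|$ is the quasi-norm of $L^{p(\cdot)}(\ell^{q(\cdot)})$ (resp. $\ell^{q(\cdot)}(L^{p(\cdot)})$); $M^{s(\cdot)}_{p(\cdot),q(\cdot)}=\dot M^{s(\cdot)}_{p(\cdot),q(\cdot)}\cap L^{p(\cdot)}$ and $N^{s(\cdot)}_{p(\cdot),q(\cdot)}=\dot N^{s(\cdot)}_{p(\cdot),q(\cdot)}\cap L^{p(\cdot)}$. **Theorem.** Write $u_X=\frac1{\mu(X)}\int_Xu\,d\mu$. (i) If $sp\ll Q$, there is a constant $C_S>0$, depending only on $b,\delta,\operatorname{diam}X,\mu(X),p,s,Q$, such that with $\gamma=\frac{Qp}{Q-sp}$,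 for all $u\in\dot M^{s(\cdot)}_{p(\cdot),q(\cdot)}$ and $g\in\mathbb D^{s(\cdot)}(u)\cap L^{p(\cdot)}(\ell^{q(\cdot)})$, $$\inf_{c\in\mathbb R}\|u-c\|_{L^{\gamma(\cdot)}}\le C_S\|g\|_{L^{p(\cdot)}(\ell^{q(\cdot)})},$$ and for all $u\in M^{s(\cdot)}_{p(\cdot),q(\cdot)}$ and $g\in\mathbb D^{s(\cdot)}(u)\cap L^{p(\cdot)}(\ell^{q(\cdot)})$, $$\|u\|_{L^{\gamma(\cdot)}}\le C_S\big(\|u\|_{L^{p(\cdot)}}+\|g\|_{L^{p(\cdot)}(\ell^{q(\cdot)})}\big).$$ (ii) If $sp=Q$, there are constants $C_1,C_2>0$, depending only on $b,\delta,\operatorname{diam}X,p,s,Q$, such that every $u\in\dot M^{s(\cdot)}_{p(\cdot),q(\cdot)}$ admitting a $g\in\mathbb D^{s(\cdot)}(u)\cap L^{p(\cdot)}(\ell^{q(\cdot)})$ with $\|g\|_{L^{p(\cdot)}(\ell^{q(\cdot)})}>0$ is integrable, and for every such $g$ $$\frac1{\mu(X)}\int_X\exp\Big(C_1\frac{|u-u_X|}{\|g\|_{L^{p(\cdot)}(\ell^{q(\cdot)})}}\Big)\,d\mu\le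 C_2.$$ (iii) If $sp\gg Q$, there are constants $C_H,D_H>0$, depending only on $b,\delta,\operatorname{diam}X,p,s,Q$, such that for all $u\in\dot M^{s(\cdot)}_{p(\cdot),q(\cdot)}$ and $g\in\mathbb D^{s(\cdot)}(u)\cap L^{p(\cdot)}(\ell^{q(\cdot)})$ the function $u$ is integrable, $$\|u-u_X\|_{L^\infty}\le C_H\|g\|_{L^{p(\cdot)}(\ell^{q(\cdot)})},$$ and $u$ has a continuous representative $\tilde u$ with $$|\tilde u(x)-\tilde u(y)|\le D_H\|g\|_{L^{p(\cdot)}(\ell^{q(\cdot)})}\,d(x,y)^{\alpha(x)}\quad\text{for all }x,y\in X,\qquad \alpha=s-\frac Qp.$$ If moreover $q\le p$ on $X$, all these statements remain valid with $\dot M,M$ replaced by $\dot N,N$ and $L^{p(\cdot)}(\ell^{q(\cdot)})$ replaced by $\ell^{q(\cdot)}(L^{p(\cdot)})$. -/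

import Mathlib

open MeasureTheory Set
open scoped ENNReal

noncomputable section

namespace HajlaszEmbedding

variable {X : Type*}

/-! ### Variable exponents -/

/-- The class `𝒫(X)` of variable exponents: measurable functions `q : X → (0, ∞]` whose essential
infimum is positive. -/
structure IsVarExponent [MeasurableSpace X] (μ : Measure X) (q : X → ℝ≥0∞) : Prop where
  measurable : Measurable q
  pos : ∀ x, 0 < q x
  essInf_pos : 0 < essInf q μ

/-- The class `𝒫_b(X)` of essentially bounded variable exponents, for finite-valued functions. -/
structure IsBddExponent [MeasurableSpace X] (μ : Measure X) (p : X → ℝ) : Prop where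
  measurable : Measurable p
  pos : ∀ x, 0 < p x
  ess_lower : ∃ a : ℝ, 0 < a ∧ ∀ᵐ x ∂μ, a ≤ p x
  ess_upper : ∃ a : ℝ, ∀ᵐ x ∂μ, p x ≤ a

/-- (Local) log-Hölder continuity on the whole space. For `x = y` the condition is trivial. -/
def LogHolder [MetricSpace X] (f : X → ℝ) : Prop :=
  ∃ C : ℝ, 0 < C ∧ ∀ x y : X, |f x - f y| ≤ C / Real.log (Real.exp 1 + 1 / dist x y)

/-- The class `𝒫_b^log(X)`: bounded exponents `p` such that `1/p` is log-Hölder continuous.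
If every ball has positive measure, then a `(0, ∞]`-valued essentially bounded exponent with
continuous reciprocal is finite everywhere, so that real-valued functions suffice. -/
structure IsBddLogExponent [MetricSpace X] [MeasurableSpace X] (μ : Measure X) (p : X → ℝ) :
    Prop where
  bdd : IsBddExponent μ p
  log : LogHolder (fun x => 1 / p x)

/-- `f ≪ g`, that is, the essential infimum of `g - f` is positive. -/
def MuchLess [MeasurableSpace X] (μ : Measure X) (f g : X → ℝ) : Prop :=
  ∃ a : ℝ, 0 < a ∧ ∀ᵐ x ∂μ, a ≤ g x - f x

/-! ### Metric measure spaces of variable dimension -/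

/-- `(X, d, μ)` is a metric measure space: all balls have positive and finite measure. -/
def IsMetricMeasure [MetricSpace X] [MeasurableSpace X] (μ : Measure X) : Prop :=
  ∀ (x : X) (r : ℝ), 0 < r → 0 < μ (Metric.ball x r) ∧ μ (Metric.ball x r) < ∞

/-- The lower measure bound `μ(B(x, r)) ≥ b r^{Q(x)}` for all `x` and all `r ∈ (0, δ]`. -/
def LowerMeasureBound [MetricSpace X] [MeasurableSpace X] (μ : Measure X) (b δ : ℝ) (Q : X → ℝ) :
    Prop :=
  ∀ (x : X) (r : ℝ), 0 < r → r ≤ δ → ENNReal.ofReal (b * r ^ Q x) ≤ μ (Metric.ball x r)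

/-! ### Variable exponent Lebesgue spaces
Moduli of functions are `[0, ∞]`-valued. -/

/-- The semi-modular `ρ_{p(·)}(f) = ∫ f(x)^{p(x)} dμ(x)`. -/
def modular [MeasurableSpace X] (μ : Measure X) (p : X → ℝ) (f : X → ℝ≥0∞) : ℝ≥0∞ :=
  ∫⁻ x, f x ^ p x ∂μ

/-- The Luxemburg quasi-norm of `L^{p(·)}(X, μ)`; it is `∞` if no `t` is admissible. -/
def lpNorm [MeasurableSpace X] (μ : Measure X) (p : X → ℝ) (f : X → ℝ≥0∞) : ℝ≥0∞ :=
  sInf {t : ℝ≥0∞ | 0 < t ∧ t < ∞ ∧ modular μ p (fun x => f x / t) ≤ 1}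

/-- `f ∈ L^{p(·)}(X, μ)`, for the modulus `f` of a function. -/
def MemLpVar [MeasurableSpace X] (μ : Measure X) (p : X → ℝ) (f : X → ℝ≥0∞) : Prop :=
  Measurable f ∧ modular μ p f < ∞

/-! ### Mixed Lebesgue sequence spaces -/

/-- The pointwise norm `‖{g_k(x)}_k‖_{ℓ^{q(x)}}`. -/
def ellNorm (q : X → ℝ≥0∞) (g : ℤ → X → ℝ≥0∞) (x : X) : ℝ≥0∞ :=
  if q x = ∞ then ⨆ k, g k x else (∑' k, g k x ^ (q x).toReal) ^ (1 / (q x).toReal)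

/-- The semi-modular of `ℓ^{q(·)}(L^{p(·)}(X, μ))`. The exponent `(q x)⁻¹.toReal` is `1 / q(x)`,
and it is `0` for `q(x) = ∞`, so that `t^{1/∞} = 1`. -/
def besovModular [MeasurableSpace X] (μ : Measure X) (p : X → ℝ) (q : X → ℝ≥0∞)
    (g : ℤ → X → ℝ≥0∞) : ℝ≥0∞ :=
  ∑' k, sInf {t : ℝ≥0∞ | 0 < t ∧ t < ∞ ∧
    modular μ p (fun x => g k x / t ^ ((q x)⁻¹).toReal) ≤ 1}

/-- The two scales of spaces: Triebel–Lizorkin (`M`) and Besov (`N`). -/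
inductive Scale
  | triebelLizorkin
  | besov

/-- The quasi-norm of `L^{p(·)}(ℓ^{q(·)}(X, μ))` for the Triebel–Lizorkin scale, and of
`ℓ^{q(·)}(L^{p(·)}(X, μ))` for the Besov scale. -/
def mixedNorm [MeasurableSpace X] (A : Scale) (μ : Measure X) (p : X → ℝ) (q : X → ℝ≥0∞)
    (g : ℤ → X → ℝ≥0∞) : ℝ≥0∞ :=
  match A with
  | .triebelLizorkin => lpNorm μ p (ellNorm q g)
  | .besov => sInf {t : ℝ≥0∞ | 0 < t ∧ t < ∞ ∧ besovModular μ p q (fun k x => g k x / t) ≤ 1}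

/-- Membership in `L^{p(·)}(ℓ^{q(·)}(X, μ))`, respectively in `ℓ^{q(·)}(L^{p(·)}(X, μ))`. -/
def MemMixed [MeasurableSpace X] (A : Scale) (μ : Measure X) (p : X → ℝ) (q : X → ℝ≥0∞)
    (g : ℤ → X → ℝ≥0∞) : Prop :=
  match A with
  | .triebelLizorkin => (∀ k, Measurable (g k)) ∧ MemLpVar μ p (ellNorm q g)
  | .besov => (∀ k, MemLpVar μ p (g k)) ∧
      ∃ t : ℝ≥0∞, 0 < t ∧ t < ∞ ∧ besovModular μ p q (fun k x => g k x / t) < ∞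

/-! ### Hajłasz–Triebel–Lizorkin and Hajłasz–Besov spaces -/

/-- `{g_k}` is a vector `s(·)`-gradient of `u`, that is, `g ∈ 𝔻^{s(·)}(u)`. -/
def IsVectorGradient [MetricSpace X] [MeasurableSpace X] (μ : Measure X) (s : X → ℝ)
    (u : X → EReal) (g : ℤ → X → ℝ≥0∞) : Prop :=
  (∀ k, Measurable (g k)) ∧
  ∃ N : Set X, μ N = 0 ∧ ∀ (k : ℤ) (x y : X), x ∉ N → y ∉ N →
    (2 : ℝ) ^ (-k - 1) ≤ dist x y → dist x y < (2 : ℝ) ^ (-k) →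
    (u x - u y).abs ≤
      ENNReal.ofReal (dist x y ^ s x) * g k x + ENNReal.ofReal (dist x y ^ s y) * g k y

/-- The homogeneous quasi-semi-norm: the infimum of the mixed quasi-norms of the vector
gradients. -/
def homNorm [MetricSpace X] [MeasurableSpace X] (A : Scale) (μ : Measure X) (s p : X → ℝ)
    (q : X → ℝ≥0∞) (u : X → EReal) : ℝ≥0∞ :=
  ⨅ g : {g : ℤ → X → ℝ≥0∞ // IsVectorGradient μ s u g}, mixedNorm A μ p q g.1

/-- The homogeneous space `Ṁ^{s(·)}_{p(·),q(·)}(X, d, μ)`, respectively `Ṅ^{s(·)}_{p(·),q(·)}`. -/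
structure MemHom [MetricSpace X] [MeasurableSpace X] (A : Scale) (μ : Measure X) (s p : X → ℝ)
    (q : X → ℝ≥0∞) (u : X → EReal) : Prop where
  measurable : Measurable u
  ae_finite : ∀ᵐ x ∂μ, u x ≠ ⊤ ∧ u x ≠ ⊥
  homNorm_lt_top : homNorm A μ s p q u < ∞

/-- The inhomogeneous space `M^{s(·)}_{p(·),q(·)}(X, d, μ)`, respectively
`N^{s(·)}_{p(·),q(·)}`. -/
structure MemInhom [MetricSpace X] [MeasurableSpace X] (A : Scale) (μ : Measure X) (s p : X → ℝ)
    (q : X → ℝ≥0∞) (u : X → EReal) : Prop where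
  memHom : MemHom A μ s p q u
  memLp : MemLpVar μ p (fun x => (u x).abs)

/-! ### The setting of the embedding theorem -/

/-- The standing assumptions on the measure and on the exponents `Q, p, s`. -/
structure Setting [MetricSpace X] [MeasurableSpace X] (μ : Measure X) (b δ : ℝ)
    (Q p s : X → ℝ) : Prop where
  metricMeasure : IsMetricMeasure μ
  Q_log : IsBddLogExponent μ Q
  lower : LowerMeasureBound μ b δ Q
  p_log : IsBddLogExponent μ p
  s_log : IsBddLogExponent μ s

/-- The condition on `q`: any variable exponent for the Triebel–Lizorkin scale, and moreover
`q ≤ p` for the Besov scale. -/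
def AdmissibleExponent [MeasurableSpace X] (A : Scale) (μ : Measure X) (p : X → ℝ)
    (q : X → ℝ≥0∞) : Prop :=
  IsVarExponent μ q ∧ (A = Scale.besov → ∀ x, q x ≤ ENNReal.ofReal (p x))

/-- The integral average `u_X` of `u` over the whole space. -/
def mean [MeasurableSpace X] (μ : Measure X) (u : X → EReal) : ℝ :=
  ⨍ x, (u x).toReal ∂μ

end HajlaszEmbedding

end

/-!
Put `G = sup_k g_k`. It is a scalar Hajłasz gradient of `u`, and its `L^p` norm is controlled by
the mixed norm (on the Besov scale because `q ≤ p`). For `t` above that norm, `H = (G / t) ^ p` has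
integral at most `1`, so by Chebyshev's inequality and the lower bound on the measure of balls every
point is within `K₀ * 2 ^ (-k / Q)` of the level set `E_k = {H ≤ 2 ^ k}`. Chain a point `x ∈ E_k`
through `E_{k-1}, …, E_{k₀}`: the step at level `i` changes `u / t` by at most a multiple of
`2 ^ (i * (1 / p - s / Q))`, where log-Hölder continuity allows all exponents to be frozen at `x`.
If `s p < Q` the geometric sum is dominated by its last term and `|u / t - c| ^ γ ≲ 1 + H`; if
`s p = Q` it has about `log H` terms of size one, whence exponential integrability; if `s p > Q` it
converges, and stopping it at the scale `d(x, y)` gives Hölder continuity.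
-/

namespace HajlaszEmbedding

section DyadicLogHolder

variable {X : Type*} [MetricSpace X] {Λ : ℝ} {f g : X → ℝ}

/-- Log-Hölder continuity in dyadic form: at scale `2 ^ (-i / Λ)` the oscillation of `f` is
`O(1 / i)`, so that `2 ^ (i * f x)` is determined up to a constant factor by a point at that
distance from `x`. -/
def DyadicLogHolder (Λ : ℝ) (f : X → ℝ) : Prop :=
  ∀ K : ℝ, ∃ M : ℝ, ∀ (i : ℕ) (x y : X),
    dist x y ≤ K * (2 : ℝ) ^ (-(i / Λ) : ℝ) → i * |f x - f y| ≤ M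

lemma DyadicLogHolder.sub (hf : DyadicLogHolder Λ f) (hg : DyadicLogHolder Λ g) :
    DyadicLogHolder Λ (fun x => f x - g x) := by
  intro K
  obtain ⟨M, hM⟩ := hf K
  obtain ⟨M', hM'⟩ := hg K
  refine ⟨M + M', fun i x y hxy => ?_⟩
  calc (i : ℝ) * |f x - g x - (f y - g y)| = i * |(f x - f y) - (g x - g y)| := by ring_nf
    _ ≤ i * (|f x - f y| + |g x - g y|) := by gcongr; exact abs_sub _ _
    _ = i * |f x - f y| + i * |g x - g y| := mul_add _ _ _
    _ ≤ M + M' := add_le_add (hM i x y hxy) (hM' i x y hxy)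

lemma DyadicLogHolder.mul {B : ℝ} (hf : DyadicLogHolder Λ f) (hg : DyadicLogHolder Λ g)
    (hfB : ∀ x, |f x| ≤ B) (hgB : ∀ x, |g x| ≤ B) :
    DyadicLogHolder Λ (fun x => f x * g x) := by
  intro K
  obtain ⟨M, hM⟩ := hf K
  obtain ⟨M', hM'⟩ := hg K
  refine ⟨B * M + B * M', fun i x y hxy => ?_⟩
  have hB : 0 ≤ B := (abs_nonneg _).trans (hfB x)
  calc (i : ℝ) * |f x * g x - f y * g y| = i * |g x * (f x - f y) + f y * (g x - g y)| := by
        ring_nf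
    _ ≤ i * (|g x| * |f x - f y| + |f y| * |g x - g y|) := by
        rw [← abs_mul, ← abs_mul]
        gcongr
        exact abs_add_le _ _
    _ = |g x| * (i * |f x - f y|) + |f y| * (i * |g x - g y|) := by ring
    _ ≤ B * M + B * M' := by
        gcongr
        exacts [hgB x, hM i x y hxy, hfB y, hM' i x y hxy]

lemma DyadicLogHolder.inv {B : ℝ} (hf : DyadicLogHolder Λ f) (hpos : ∀ x, 0 < f x)
    (hfB : ∀ x, (f x)⁻¹ ≤ B) : DyadicLogHolder Λ (fun x => (f x)⁻¹) := by
  intro K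
  obtain ⟨M, hM⟩ := hf K
  refine ⟨B * B * M, fun i x y hxy => ?_⟩
  have hx := hpos x
  have hy := hpos y
  have hB : 0 ≤ B := (inv_pos.2 hx).le.trans (hfB x)
  calc (i : ℝ) * |(f x)⁻¹ - (f y)⁻¹| = i * |(f x)⁻¹ * (f y)⁻¹ * (f y - f x)| := by
        congr 2
        field_simp
    _ = (f x)⁻¹ * (f y)⁻¹ * (i * |f x - f y|) := by
        rw [abs_mul, abs_of_pos (by positivity), abs_sub_comm]
        ring
    _ ≤ B * B * M := by
        gcongr
        exacts [hfB x, hfB y, hM i x y hxy]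

lemma DyadicLogHolder.continuous (hf : DyadicLogHolder Λ f) : Continuous f := by
  obtain ⟨M, hM⟩ := hf 1
  rw [Metric.continuous_iff]
  intro x ε hε
  obtain ⟨i, hi⟩ := exists_nat_gt (M / ε)
  refine ⟨(2 : ℝ) ^ (-(i / Λ) : ℝ), by positivity, fun y hy => ?_⟩
  have hyx : i * |f y - f x| < i * ε :=
    (hM i y x (by rw [one_mul]; exact hy.le)).trans_lt ((div_lt_iff₀ hε).1 hi)
  exact lt_of_mul_lt_mul_left hyx (Nat.cast_nonneg i)

lemma DyadicLogHolder.exists_rpow_le (hf : DyadicLogHolder Λ f) (K : ℝ) :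
    ∃ C : ℝ, 0 < C ∧ ∀ (i : ℕ) (x y : X), dist x y ≤ K * (2 : ℝ) ^ (-(i / Λ) : ℝ) →
      (2 : ℝ) ^ (i * f y) ≤ C * (2 : ℝ) ^ (i * f x) ∧
      (2 : ℝ) ^ (-(i * f y)) ≤ C * (2 : ℝ) ^ (-(i * f x)) := by
  obtain ⟨M, hM⟩ := hf K
  refine ⟨2 ^ M, by positivity, fun i x y hxy => ?_⟩
  have hxyM : |i * f x - i * f y| ≤ M := by
    rw [← mul_sub, abs_mul, Nat.abs_cast]
    exact hM i x y hxy
  obtain ⟨hlower, hupper⟩ := abs_le.1 hxyM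
  rw [← Real.rpow_add two_pos, ← Real.rpow_add two_pos]
  constructor <;> exact Real.rpow_le_rpow_of_exponent_le one_le_two (by linarith)

lemma exists_natCast_le_mul_log (hΛ : 0 < Λ) (K : ℝ) :
    ∃ C : ℝ, ∀ (i : ℕ) (d : ℝ), 0 < d → d ≤ K * (2 : ℝ) ^ (-(i / Λ) : ℝ) →
      i ≤ C * Real.log (Real.exp 1 + 1 / d) := by
  have hlog2 : 0 < Real.log 2 := Real.log_pos one_lt_two
  refine ⟨(1 + |Real.log K|) * Λ / Real.log 2, fun i d hd hdK => ?_⟩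
  set ℓ := Real.log (Real.exp 1 + 1 / d)
  have hℓ_one : 1 ≤ ℓ := by
    rw [Real.le_log_iff_exp_le (by positivity)]
    exact le_add_of_nonneg_right (by positivity)
  have hℓ_log : -Real.log d ≤ ℓ := by
    rw [← Real.log_inv, ← one_div]
    exact Real.log_le_log (by positivity) (le_add_of_nonneg_left (Real.exp_pos 1).le)
  have hK : 0 < K := pos_of_mul_pos_left (hd.trans_le hdK) (by positivity)
  have hlog_d : Real.log d ≤ Real.log K - i / Λ * Real.log 2 := by
    rw [sub_eq_add_neg, ← neg_mul, ← Real.log_rpow two_pos, ← Real.log_mul hK.ne' (by positivity)]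
    exact Real.log_le_log hd hdK
  have hi : i / Λ * Real.log 2 ≤ (1 + |Real.log K|) * ℓ := by
    nlinarith [le_abs_self (Real.log K), abs_nonneg (Real.log K)]
  rw [div_mul_eq_mul_div, le_div_iff₀ hlog2]
  calc i * Real.log 2 = i / Λ * Real.log 2 * Λ := by field_simp
    _ ≤ (1 + |Real.log K|) * ℓ * Λ := by gcongr
    _ = (1 + |Real.log K|) * Λ * ℓ := by ring

lemma LogHolder.dyadicLogHolder (hΛ : 0 < Λ) (hf : LogHolder f) : DyadicLogHolder Λ f := by
  obtain ⟨C, -, hfC⟩ := hf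
  intro K
  obtain ⟨M, hM⟩ := exists_natCast_le_mul_log hΛ K
  refine ⟨max (M * C) 0, fun i x y hxy => ?_⟩
  rcases eq_or_ne x y with rfl | hne
  · rw [sub_self, abs_zero, mul_zero]
    exact le_max_right _ _
  have hd : 0 < dist x y := dist_pos.2 hne
  have hlog : 0 < Real.log (Real.exp 1 + 1 / dist x y) :=
    Real.log_pos ((Real.one_lt_exp_iff.2 one_pos).trans (lt_add_of_pos_right _ (by positivity)))
  calc (i : ℝ) * |f x - f y|
      ≤ M * Real.log (Real.exp 1 + 1 / dist x y) *
          (C / Real.log (Real.exp 1 + 1 / dist x y)) :=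
        mul_le_mul (hM i _ hd hxy) (hfC x y) (abs_nonneg _)
          ((Nat.cast_nonneg i).trans (hM i _ hd hxy))
    _ = M * C := by rw [mul_assoc, mul_div_cancel₀ _ hlog.ne']
    _ ≤ max (M * C) 0 := le_max_left _ _

end DyadicLogHolder

section DyadicScales

variable {β₀ β : ℝ} {j k : ℕ}

lemma one_sub_two_rpow_neg_pos (h₀ : 0 < β₀) : 0 < 1 - (2 : ℝ) ^ (-β₀) :=
  sub_pos.2 (Real.rpow_lt_one_of_one_lt_of_neg one_lt_two (neg_neg_of_pos h₀))

lemma sum_Ioc_two_rpow_le_of_pos (h₀ : 0 < β₀) (h : β₀ ≤ β) (hjk : j ≤ k) :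
    ∑ i ∈ Finset.Ioc j k, (2 : ℝ) ^ (i * β) ≤ (1 - 2 ^ (-β₀))⁻¹ * 2 ^ (k * β) := by
  have hθ := one_sub_two_rpow_neg_pos h₀
  induction k, hjk using Nat.le_induction with
  | base =>
    rw [Finset.Ioc_self, Finset.sum_empty]
    positivity
  | succ k hk ih =>
    have hstep : (2 : ℝ) ^ (k * β) ≤ 2 ^ (-β₀) * 2 ^ ((k + 1 : ℕ) * β) := by
      rw [← Real.rpow_add two_pos]
      apply Real.rpow_le_rpow_of_exponent_le one_le_two
      push_cast
      linarith
    rw [Finset.sum_Ioc_succ_top (by omega)]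
    calc ∑ i ∈ Finset.Ioc j k, (2 : ℝ) ^ (i * β) + 2 ^ ((k + 1 : ℕ) * β)
        ≤ (1 - 2 ^ (-β₀))⁻¹ * (2 ^ (-β₀) * 2 ^ ((k + 1 : ℕ) * β)) + 2 ^ ((k + 1 : ℕ) * β) := by
          gcongr
          exact ih.trans (by gcongr)
      _ = ((1 - 2 ^ (-β₀))⁻¹ * 2 ^ (-β₀) + 1) * 2 ^ ((k + 1 : ℕ) * β) := by ring
      _ = (1 - 2 ^ (-β₀))⁻¹ * 2 ^ ((k + 1 : ℕ) * β) := by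
          congr 1
          field_simp
          ring

lemma sum_Ioc_two_rpow_le_of_neg (h₀ : 0 < β₀) (h : β ≤ -β₀) (hjk : j ≤ k) :
    ∑ i ∈ Finset.Ioc j k, (2 : ℝ) ^ (i * β) ≤ (1 - 2 ^ (-β₀))⁻¹ * 2 ^ (j * β) := by
  have hθ := one_sub_two_rpow_neg_pos h₀
  induction hjk using Nat.decreasingInduction with
  | self =>
    rw [Finset.Ioc_self, Finset.sum_empty]
    positivity
  | of_succ j hjk ih =>
    have hstep : (2 : ℝ) ^ ((j + 1 : ℕ) * β) ≤ 2 ^ (-β₀) * 2 ^ (j * β) := by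
      rw [← Real.rpow_add two_pos]
      apply Real.rpow_le_rpow_of_exponent_le one_le_two
      push_cast
      linarith
    rw [← Finset.insert_Ioc_succ_left_eq_Ioc hjk, Finset.sum_insert (by simp)]
    calc (2 : ℝ) ^ ((j + 1 : ℕ) * β) + ∑ i ∈ Finset.Ioc (j + 1) k, (2 : ℝ) ^ (i * β)
        ≤ 2 ^ ((j + 1 : ℕ) * β) + (1 - 2 ^ (-β₀))⁻¹ * 2 ^ ((j + 1 : ℕ) * β) := by gcongr
      _ = (1 + (1 - 2 ^ (-β₀))⁻¹) * 2 ^ ((j + 1 : ℕ) * β) := by ring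
      _ ≤ (1 + (1 - 2 ^ (-β₀))⁻¹) * (2 ^ (-β₀) * 2 ^ (j * β)) := by gcongr
      _ = (1 + (1 - 2 ^ (-β₀))⁻¹) * 2 ^ (-β₀) * 2 ^ (j * β) := by ring
      _ ≤ (1 - 2 ^ (-β₀))⁻¹ * 2 ^ (j * β) := by
          gcongr
          field_simp
          nlinarith [sq_nonneg (1 - (2 : ℝ) ^ (-β₀))]

lemma exists_stopping_scale (k₀ : ℕ) {r d K : ℝ} (hr : 0 < r) (hd : 0 < d) (hK : 1 ≤ K)
    (hdK : d ≤ K * (2 : ℝ) ^ (-(k₀ * r))) :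
    ∃ j : ℕ, k₀ ≤ j ∧ (2 : ℝ) ^ (-((j + 1 : ℕ) * r)) ≤ d ∧ d ≤ K * (2 : ℝ) ^ (-(j * r)) := by
  rcases le_or_gt ((2 : ℝ) ^ (-(k₀ * r))) d with hle | hlt
  · refine ⟨k₀, le_rfl, le_trans ?_ hle, hdK⟩
    gcongr
    exacts [one_le_two, Nat.le_succ k₀]
  have hpow : ∀ n : ℕ, (2 : ℝ) ^ (-(((k₀ + n : ℕ) : ℝ) * r)) =
      ((2 : ℝ) ^ (-r)) ^ n * (2 : ℝ) ^ (-(k₀ * r)) := by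
    intro n
    rw [← Real.rpow_natCast, ← Real.rpow_mul two_pos.le, ← Real.rpow_add two_pos]
    push_cast
    ring_nf
  obtain ⟨n, hn, hn'⟩ := exists_nat_pow_near_of_lt_one (x := d / (2 : ℝ) ^ (-(k₀ * r)))
    (y := (2 : ℝ) ^ (-r)) (by positivity) ((div_le_one (by positivity)).2 hlt.le) (by positivity)
    (Real.rpow_lt_one_of_one_lt_of_neg one_lt_two (neg_neg_of_pos hr))
  rw [lt_div_iff₀ (by positivity), ← hpow] at hn
  rw [div_le_iff₀ (by positivity), ← hpow] at hn'
  exact ⟨k₀ + n, Nat.le_add_right _ _, hn.le,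
    hn'.trans (le_mul_of_one_le_left (by positivity) hK)⟩

end DyadicScales

section Chaining

variable {X : Type*} [MetricSpace X] {Λ : ℝ} {P s R : X → ℝ}

/-- The reciprocal exponents `P = 1 / p`, `R = 1 / Q` and the smoothness `s` take values in
`[Λ⁻¹, Λ]` and are log-Hölder continuous at the dyadic scales `2 ^ (-i / Λ) ≥ 2 ^ (-i R)`. -/
structure ReciprocalExponents (Λ : ℝ) (P s R : X → ℝ) : Prop where
  one_le : 1 ≤ Λ
  P_mem : ∀ x, P x ∈ Icc Λ⁻¹ Λ
  s_mem : ∀ x, s x ∈ Icc Λ⁻¹ Λ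
  R_mem : ∀ x, R x ∈ Icc Λ⁻¹ Λ
  P_log : DyadicLogHolder Λ P
  s_log : DyadicLogHolder Λ s
  R_log : DyadicLogHolder Λ R

/-- An increasing family of sets `E k` such that, for `k₀ ≤ k`, every point `x` is within distance
`K₀ * 2 ^ (-k / Q(x))` of `E k`, and such that on `E k` the function `w` has the Hajłasz gradient
`2 ^ (k / p)`. -/
structure IsLevelFamily (P s R : X → ℝ) (K₀ : ℝ) (k₀ : ℕ) (E : ℕ → Set X) (w : X → ℝ) :
    Prop where
  mono : Monotone E
  near : ∀ k, k₀ ≤ k → ∀ x, ∃ y ∈ E k, dist x y ≤ K₀ * (2 : ℝ) ^ (-(k * R x))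
  osc : ∀ k, ∀ x ∈ E k, ∀ y ∈ E k,
    |w x - w y| ≤ dist x y ^ s x * (2 : ℝ) ^ (k * P x) + dist x y ^ s y * (2 : ℝ) ^ (k * P y)

namespace ReciprocalExponents

lemma pos (h : ReciprocalExponents Λ P s R) : 0 < Λ := zero_lt_one.trans_le h.one_le

lemma P_pos (h : ReciprocalExponents Λ P s R) (x : X) : 0 < P x :=
  (inv_pos.2 h.pos).trans_le (h.P_mem x).1

lemma s_pos (h : ReciprocalExponents Λ P s R) (x : X) : 0 < s x :=
  (inv_pos.2 h.pos).trans_le (h.s_mem x).1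

lemma R_pos (h : ReciprocalExponents Λ P s R) (x : X) : 0 < R x :=
  (inv_pos.2 h.pos).trans_le (h.R_mem x).1

lemma gap_log (h : ReciprocalExponents Λ P s R) :
    DyadicLogHolder Λ (fun x => P x - s x * R x) :=
  h.P_log.sub (h.s_log.mul (B := Λ) h.R_log
    (fun x => (abs_of_pos (h.s_pos x)).trans_le (h.s_mem x).2)
    (fun x => (abs_of_pos (h.R_pos x)).trans_le (h.R_mem x).2))

lemma gap_le (h : ReciprocalExponents Λ P s R) (x : X) : P x - s x * R x ≤ Λ :=
  (sub_le_self _ (mul_pos (h.s_pos x) (h.R_pos x)).le).trans (h.P_mem x).2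

lemma neg_le_gap (h : ReciprocalExponents Λ P s R) (x : X) : -(Λ * Λ) ≤ P x - s x * R x := by
  have hsR : s x * R x ≤ Λ * Λ :=
    mul_le_mul (h.s_mem x).2 (h.R_mem x).2 (h.R_pos x).le h.pos.le
  linarith [h.P_pos x]

lemma le_mul_two_rpow_of_le (h : ReciprocalExponents Λ P s R) {d K : ℝ} (hK : 0 ≤ K) {i : ℕ}
    {x : X} (hd : d ≤ K * (2 : ℝ) ^ (-(i * R x))) : d ≤ K * (2 : ℝ) ^ (-(i / Λ) : ℝ) := by
  refine hd.trans ?_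
  rw [div_eq_mul_inv]
  gcongr
  exacts [one_le_two, (h.R_mem x).1]

lemma le_mul_two_rpow (h : ReciprocalExponents Λ P s R) {d D : ℝ} (hD : 0 ≤ D) (hd : d ≤ D)
    (i : ℕ) (x : X) : d ≤ D * 2 ^ (i * Λ) * (2 : ℝ) ^ (-(i * R x)) := by
  rw [mul_assoc, ← Real.rpow_add two_pos, ← sub_eq_add_neg, ← mul_sub]
  refine hd.trans (le_mul_of_one_le_right hD (Real.one_le_rpow one_le_two ?_))
  exact mul_nonneg (Nat.cast_nonneg i) (sub_nonneg.2 (h.R_mem x).2)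

lemma exists_dist_rpow_le (h : ReciprocalExponents Λ P s R) {K : ℝ} (hK : 0 ≤ K) :
    ∃ C : ℝ, 0 < C ∧ ∀ (i : ℕ) (x y z v : X), dist x v ≤ K * (2 : ℝ) ^ (-(i * R x)) →
      dist y z ≤ K * (2 : ℝ) ^ (-(i * R x)) →
      dist y z ^ s v ≤ C * (2 : ℝ) ^ (-(i * (s x * R x))) := by
  obtain ⟨M, hM⟩ := h.s_log K
  refine ⟨(K + 1) ^ Λ * 2 ^ (Λ * M), by positivity, fun i x y z v hxv hyz => ?_⟩
  have hs : i * |s x - s v| ≤ M := hM i x v (h.le_mul_two_rpow_of_le hK hxv)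
  have hfreeze : R x * (i * (s x - s v)) ≤ Λ * M := by
    calc R x * (i * (s x - s v)) ≤ R x * (i * |s x - s v|) := by
          have := (h.R_pos x).le
          gcongr
          exact le_abs_self _
      _ ≤ Λ * M := mul_le_mul (h.R_mem x).2 hs (by positivity) h.pos.le
  calc dist y z ^ s v ≤ ((K + 1) * (2 : ℝ) ^ (-(i * R x))) ^ s v := by
        refine Real.rpow_le_rpow dist_nonneg (hyz.trans ?_) (h.s_pos v).le
        gcongr
        exact le_add_of_nonneg_right zero_le_one
    _ = (K + 1) ^ s v * (2 : ℝ) ^ (-(i * R x) * s v) := by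
        rw [Real.mul_rpow (by positivity) (by positivity), ← Real.rpow_mul (by positivity)]
    _ ≤ (K + 1) ^ Λ * (2 : ℝ) ^ (Λ * M + -(i * (s x * R x))) := by
        gcongr
        exacts [le_add_of_nonneg_left hK, (h.s_mem v).2, one_le_two, by linarith]
    _ = (K + 1) ^ Λ * 2 ^ (Λ * M) * (2 : ℝ) ^ (-(i * (s x * R x))) := by
        rw [Real.rpow_add two_pos, ← mul_assoc]

lemma exists_osc_le (h : ReciprocalExponents Λ P s R) {K : ℝ} (hK : 0 ≤ K) :
    ∃ C : ℝ, 0 < C ∧ ∀ (K₀ : ℝ) (k₀ : ℕ) (E : ℕ → Set X) (w : X → ℝ),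
      IsLevelFamily P s R K₀ k₀ E w → ∀ (i : ℕ) (x y z : X), y ∈ E i → z ∈ E i →
      dist x y ≤ K * (2 : ℝ) ^ (-(i * R x)) → dist x z ≤ K * (2 : ℝ) ^ (-(i * R x)) →
      |w y - w z| ≤ C * (2 : ℝ) ^ (i * (P x - s x * R x)) := by
  obtain ⟨C₁, hC₁, hdist⟩ := h.exists_dist_rpow_le (K := 2 * K) (by positivity)
  obtain ⟨C₂, hC₂, hP⟩ := h.P_log.exists_rpow_le (2 * K)
  refine ⟨2 * (C₁ * C₂), by positivity, fun K₀ k₀ E w hE i x y z hy hz hxy hxz => ?_⟩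
  have hnear : ∀ {d : ℝ}, d ≤ K * (2 : ℝ) ^ (-(i * R x)) →
      d ≤ 2 * K * (2 : ℝ) ^ (-(i * R x)) := fun hd => hd.trans (by gcongr; linarith)
  have hyz : dist y z ≤ 2 * K * (2 : ℝ) ^ (-(i * R x)) := by
    linarith [dist_triangle_left y z x]
  have hterm : ∀ v, dist x v ≤ 2 * K * (2 : ℝ) ^ (-(i * R x)) →
      dist y z ^ s v * (2 : ℝ) ^ (i * P v) ≤ C₁ * C₂ * (2 : ℝ) ^ (i * (P x - s x * R x)) := by
    intro v hv
    calc dist y z ^ s v * (2 : ℝ) ^ (i * P v)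
        ≤ (C₁ * (2 : ℝ) ^ (-(i * (s x * R x)))) * (C₂ * (2 : ℝ) ^ (i * P x)) := by
          gcongr
          exacts [hdist i x y z v hv hyz,
            (hP i x v (h.le_mul_two_rpow_of_le (by positivity) hv)).1]
      _ = C₁ * C₂ * ((2 : ℝ) ^ (i * P x) * (2 : ℝ) ^ (-(i * (s x * R x)))) := by ring
      _ = C₁ * C₂ * (2 : ℝ) ^ (i * (P x - s x * R x)) := by
          rw [← Real.rpow_add two_pos, ← sub_eq_add_neg, ← mul_sub]
  linarith [hE.osc i y hy z hz, hterm y (hnear hxy), hterm z (hnear hxz)]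

lemma two_rpow_neg_succ_mul_R_le (h : ReciprocalExponents Λ P s R) (j : ℕ) (x : X) :
    (2 : ℝ) ^ (-((j + 1 : ℕ) * R x)) ≤ 2 ^ (-Λ⁻¹) * (2 : ℝ) ^ (-(j * R x)) := by
  rw [← Real.rpow_add two_pos]
  apply Real.rpow_le_rpow_of_exponent_le one_le_two
  push_cast
  linarith [(h.R_mem x).1]

lemma exists_chain_step (h : ReciprocalExponents Λ P s R) {K K₀ : ℝ} (hK : 0 ≤ K)
    (hK₀ : 0 < K₀) :
    ∃ C : ℝ, 0 < C ∧ ∀ (k₀ : ℕ) (E : ℕ → Set X) (w : X → ℝ),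
      IsLevelFamily P s R K₀ k₀ E w → ∀ (j : ℕ) (x y : X), k₀ ≤ j → y ∈ E (j + 1) →
      dist x y ≤ K * (2 : ℝ) ^ (-((j + 1 : ℕ) / Λ) : ℝ) →
      ∃ z ∈ E j, dist y z ≤ K₀ * (2 : ℝ) ^ (-(j / Λ) : ℝ) ∧
        dist y z ≤ C * (2 : ℝ) ^ (-(j * R x)) ∧
        |w y - w z| ≤ C * (2 : ℝ) ^ ((j + 1 : ℕ) * (P x - s x * R x)) := by
  obtain ⟨C₁, hC₁, hR⟩ := h.R_log.exists_rpow_le K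
  obtain ⟨C₂, -, hgap⟩ := h.gap_log.exists_rpow_le K
  obtain ⟨C₃, hC₃, hosc⟩ := h.exists_osc_le (K := K₀ * 2 ^ Λ) (by positivity)
  refine ⟨max (K₀ * C₁) (C₃ * C₂), by positivity, fun k₀ E w hE j x y hj hy hxy => ?_⟩
  obtain ⟨z, hz, hyz⟩ := hE.near j hj y
  have hxy_j : dist x y ≤ K * (2 : ℝ) ^ (-(j / Λ) : ℝ) := by
    have := h.pos
    refine hxy.trans ?_
    gcongr
    exacts [one_le_two, Nat.le_succ j]
  have hyz_succ : dist y z ≤ K₀ * 2 ^ Λ * (2 : ℝ) ^ (-((j + 1 : ℕ) * R y)) := by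
    refine hyz.trans ?_
    rw [mul_assoc, ← Real.rpow_add two_pos]
    gcongr
    · exact one_le_two
    · push_cast
      linarith [(h.R_mem y).2]
  refine ⟨z, hz, h.le_mul_two_rpow_of_le hK₀.le hyz, ?_, ?_⟩
  · calc dist y z ≤ K₀ * (C₁ * (2 : ℝ) ^ (-(j * R x))) :=
          hyz.trans (by gcongr; exact (hR j x y hxy_j).2)
      _ = K₀ * C₁ * (2 : ℝ) ^ (-(j * R x)) := by ring
      _ ≤ max (K₀ * C₁) (C₃ * C₂) * (2 : ℝ) ^ (-(j * R x)) := by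
          gcongr
          exact le_max_left _ _
  · calc |w y - w z| ≤ C₃ * (2 : ℝ) ^ ((j + 1 : ℕ) * (P y - s y * R y)) :=
          hosc K₀ k₀ E w hE (j + 1) y y z hy (hE.mono (Nat.le_succ j) hz)
            (by rw [dist_self]; positivity) hyz_succ
      _ ≤ C₃ * (C₂ * (2 : ℝ) ^ ((j + 1 : ℕ) * (P x - s x * R x))) := by
          gcongr
          exact (hgap (j + 1) x y hxy).1
      _ = C₃ * C₂ * (2 : ℝ) ^ ((j + 1 : ℕ) * (P x - s x * R x)) := by ring
      _ ≤ max (K₀ * C₁) (C₃ * C₂) * (2 : ℝ) ^ ((j + 1 : ℕ) * (P x - s x * R x)) := by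
          gcongr
          exact le_max_right _ _

lemma exists_chain (h : ReciprocalExponents Λ P s R) {K₀ : ℝ} (hK₀ : 0 < K₀) :
    ∃ C : ℝ, 0 < C ∧ ∀ (k₀ : ℕ) (E : ℕ → Set X) (w : X → ℝ),
      IsLevelFamily P s R K₀ k₀ E w → ∀ (j k : ℕ) (x : X), k₀ ≤ j → j ≤ k → x ∈ E k →
      ∃ y ∈ E j, dist x y ≤ C * (2 : ℝ) ^ (-(j * R x)) ∧
        |w x - w y| ≤ C * ∑ i ∈ Finset.Ioc j k, (2 : ℝ) ^ (i * (P x - s x * R x)) := by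
  have hθ := one_sub_two_rpow_neg_pos (inv_pos.2 h.pos)
  set θ : ℝ := 2 ^ (-Λ⁻¹)
  have hθ_succ : ∀ j : ℕ, (2 : ℝ) ^ (-((j + 1 : ℕ) / Λ) : ℝ) = θ * (2 : ℝ) ^ (-(j / Λ) : ℝ) := by
    intro j
    rw [← Real.rpow_add two_pos]
    push_cast
    ring_nf
  -- `K₁` and `C / (1 - θ)` are the fixed points `a` of `a ↦ a * θ + K₀` and `a ↦ a * θ + C`.
  have hfixed : ∀ a : ℝ, a / (1 - θ) * θ + a = a / (1 - θ) := fun a => by field_simp; ring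
  set K₁ := K₀ / (1 - θ)
  have hK₁ : K₁ * θ + K₀ = K₁ := hfixed K₀
  obtain ⟨C, hC, hstep⟩ := h.exists_chain_step (K := K₁) (by positivity) hK₀
  refine ⟨C / (1 - θ), by positivity, fun k₀ E w hE j k x hj hjk hx => ?_⟩
  suffices H : ∃ y ∈ E j, dist x y ≤ K₁ * (2 : ℝ) ^ (-(j / Λ) : ℝ) ∧
      dist x y ≤ C / (1 - θ) * (2 : ℝ) ^ (-(j * R x)) ∧
      |w x - w y| ≤ C * ∑ i ∈ Finset.Ioc j k, (2 : ℝ) ^ (i * (P x - s x * R x)) by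
    obtain ⟨y, hy, -, hd, hw⟩ := H
    refine ⟨y, hy, hd, hw.trans ?_⟩
    gcongr
    exact le_div_self hC.le hθ (sub_le_self _ (by positivity))
  induction hjk using Nat.decreasingInduction with
  | self => exact ⟨x, hx, by rw [dist_self]; positivity, by rw [dist_self]; positivity, by simp⟩
  | of_succ j hjk ih =>
    obtain ⟨y, hy, hd_crude, hd, hw⟩ := ih (by omega)
    obtain ⟨z, hz, hyz_crude, hyz, hyz_osc⟩ := hstep k₀ E w hE j x y hj hy hd_crude
    refine ⟨z, hz, ?_, ?_, ?_⟩
    · rw [hθ_succ] at hd_crude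
      rw [← hK₁, add_mul]
      linarith [dist_triangle x y z]
    · have hd_j := hd.trans (mul_le_mul_of_nonneg_left (h.two_rpow_neg_succ_mul_R_le j x)
        (by positivity))
      rw [← hfixed C, add_mul]
      linarith [dist_triangle x y z]
    · rw [← Finset.insert_Ioc_succ_left_eq_Ioc hjk, Finset.sum_insert (by simp), mul_add,
        Order.succ_eq_add_one]
      linarith [abs_sub_le (w x) (w y) (w z)]

lemma exists_osc_le_sum (h : ReciprocalExponents Λ P s R) {D : ℝ}
    (hD : ∀ x y : X, dist x y ≤ D) {K₀ : ℝ} (hK₀ : 0 < K₀) (k₀ : ℕ) :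
    ∃ C : ℝ, 0 < C ∧ ∀ (E : ℕ → Set X) (w : X → ℝ), IsLevelFamily P s R K₀ k₀ E w →
      ∀ (k : ℕ) (x z : X), k₀ ≤ k → x ∈ E k → z ∈ E k₀ →
      |w x - w z| ≤ C * (1 + ∑ i ∈ Finset.Ioc k₀ k, (2 : ℝ) ^ (i * (P x - s x * R x))) := by
  obtain ⟨C₁, hC₁, hchain⟩ := h.exists_chain hK₀
  obtain ⟨C₂, hC₂, hosc⟩ := h.exists_osc_le (K := |D| * 2 ^ (k₀ * Λ)) (by positivity)
  refine ⟨C₁ + C₂ * 2 ^ (k₀ * Λ), by positivity, fun E w hE k x z hk hx hz => ?_⟩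
  obtain ⟨y, hy, -, hxy⟩ := hchain k₀ E w hE k₀ k x le_rfl hk hx
  have hyz : |w y - w z| ≤ C₂ * 2 ^ (k₀ * Λ) := by
    refine (hosc K₀ k₀ E w hE k₀ y y z hy hz (by rw [dist_self]; positivity)
      (h.le_mul_two_rpow (abs_nonneg D) ((hD y z).trans (le_abs_self D)) k₀ y)).trans ?_
    gcongr
    exacts [one_le_two, h.gap_le y]
  set S := ∑ i ∈ Finset.Ioc k₀ k, (2 : ℝ) ^ (i * (P x - s x * R x))
  have hS : 0 ≤ C₂ * 2 ^ (k₀ * Λ) * S := by positivity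
  linarith [abs_sub_le (w x) (w y) (w z)]

lemma exists_osc_le_of_pos (h : ReciprocalExponents Λ P s R) {D : ℝ}
    (hD : ∀ x y : X, dist x y ≤ D) {K₀ : ℝ} (hK₀ : 0 < K₀) (k₀ : ℕ) {β₀ : ℝ} (h₀ : 0 < β₀)
    (hβ : ∀ x, β₀ ≤ P x - s x * R x) :
    ∃ C : ℝ, 0 < C ∧ ∀ (E : ℕ → Set X) (w : X → ℝ), IsLevelFamily P s R K₀ k₀ E w →
      ∀ (k : ℕ) (x z : X), k₀ ≤ k → x ∈ E k → z ∈ E k₀ →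
      |w x - w z| ≤ C * (2 : ℝ) ^ (k * (P x - s x * R x)) := by
  obtain ⟨C, hC, hosc⟩ := h.exists_osc_le_sum hD hK₀ k₀
  have hθ := one_sub_two_rpow_neg_pos h₀
  refine ⟨C * (1 + (1 - 2 ^ (-β₀))⁻¹), by positivity, fun E w hE k x z hk hx hz => ?_⟩
  have hone : (1 : ℝ) ≤ 2 ^ (k * (P x - s x * R x)) :=
    Real.one_le_rpow one_le_two (mul_nonneg (Nat.cast_nonneg k) (h₀.le.trans (hβ x)))
  calc |w x - w z| ≤ _ := hosc E w hE k x z hk hx hz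
    _ ≤ C * (2 ^ (k * (P x - s x * R x)) +
        (1 - 2 ^ (-β₀))⁻¹ * 2 ^ (k * (P x - s x * R x))) := by
        gcongr
        exact sum_Ioc_two_rpow_le_of_pos h₀ (hβ x) hk
    _ = C * (1 + (1 - 2 ^ (-β₀))⁻¹) * 2 ^ (k * (P x - s x * R x)) := by ring

lemma exists_osc_le_of_eq_zero (h : ReciprocalExponents Λ P s R) {D : ℝ}
    (hD : ∀ x y : X, dist x y ≤ D) {K₀ : ℝ} (hK₀ : 0 < K₀) (k₀ : ℕ)
    (hβ : ∀ x, P x - s x * R x = 0) :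
    ∃ C : ℝ, 0 < C ∧ ∀ (E : ℕ → Set X) (w : X → ℝ), IsLevelFamily P s R K₀ k₀ E w →
      ∀ (k : ℕ) (x z : X), k₀ ≤ k → x ∈ E k → z ∈ E k₀ → |w x - w z| ≤ C * (1 + k) := by
  obtain ⟨C, hC, hosc⟩ := h.exists_osc_le_sum hD hK₀ k₀
  refine ⟨C, hC, fun E w hE k x z hk hx hz => (hosc E w hE k x z hk hx hz).trans ?_⟩
  gcongr
  simp [hβ x]

lemma exists_osc_le_of_neg (h : ReciprocalExponents Λ P s R) {K K₀ : ℝ} (hK : 0 ≤ K)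
    (hK₀ : 0 < K₀) {β₀ : ℝ} (h₀ : 0 < β₀) (hβ : ∀ x, P x - s x * R x ≤ -β₀) :
    ∃ C : ℝ, 0 < C ∧ ∀ (k₀ : ℕ) (E : ℕ → Set X) (w : X → ℝ), IsLevelFamily P s R K₀ k₀ E w →
      ∀ (j k : ℕ) (x y : X), k₀ ≤ j → x ∈ E k → y ∈ E k →
      dist x y ≤ K * (2 : ℝ) ^ (-(j * R x)) →
      |w x - w y| ≤ C * (2 : ℝ) ^ (j * (P x - s x * R x)) := by
  have hθ := one_sub_two_rpow_neg_pos h₀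
  set c := (1 - (2 : ℝ) ^ (-β₀))⁻¹
  obtain ⟨C₁, hC₁, hchain⟩ := h.exists_chain hK₀
  obtain ⟨C₂, hC₂, hR⟩ := h.R_log.exists_rpow_le K
  obtain ⟨C₃, hC₃, hgap⟩ := h.gap_log.exists_rpow_le K
  obtain ⟨C₄, hC₄, hosc⟩ := h.exists_osc_le (K := C₁ + (K + C₁ * C₂)) (by positivity)
  refine ⟨C₁ * c + C₄ + C₁ * (c * C₃), by positivity, fun k₀ E w hE j k x y hj hx hy hxy => ?_⟩
  have hxy_crude := h.le_mul_two_rpow_of_le hK hxy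
  have hE_max := hE.mono (le_max_right j k)
  obtain ⟨x', hx', hxx', hx_osc⟩ := hchain k₀ E w hE j _ x hj (le_max_left j k) (hE_max hx)
  obtain ⟨y', hy', hyy', hy_osc⟩ := hchain k₀ E w hE j _ y hj (le_max_left j k) (hE_max hy)
  have hρ : 0 < (2 : ℝ) ^ (-(j * R x)) := by positivity
  have hxx'_le : dist x x' ≤ (C₁ + (K + C₁ * C₂)) * (2 : ℝ) ^ (-(j * R x)) := by
    have : 0 ≤ (K + C₁ * C₂) * (2 : ℝ) ^ (-(j * R x)) := by positivity
    linarith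
  have hxy'_le : dist x y' ≤ (C₁ + (K + C₁ * C₂)) * (2 : ℝ) ^ (-(j * R x)) := by
    have := mul_le_mul_of_nonneg_left (hR j x y hxy_crude).2 hC₁.le
    have := mul_pos hC₁ hρ
    linarith [dist_triangle x y y']
  set B := (2 : ℝ) ^ (j * (P x - s x * R x))
  have hmid : |w x' - w y'| ≤ C₄ * B := hosc K₀ k₀ E w hE j x x' y' hx' hy' hxx'_le hxy'_le
  have hleft : |w x - w x'| ≤ C₁ * (c * B) := hx_osc.trans <| by
    gcongr
    exact sum_Ioc_two_rpow_le_of_neg h₀ (hβ x) (le_max_left j k)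
  have hright : |w y - w y'| ≤ C₁ * (c * (C₃ * B)) := hy_osc.trans <| by
    gcongr
    exact (sum_Ioc_two_rpow_le_of_neg h₀ (hβ y) (le_max_left j k)).trans
      (by gcongr; exact (hgap j x y hxy_crude).1)
  have htri : |w x - w y| ≤ |w x - w x'| + |w x' - w y'| + |w y - w y'| := by
    linarith [abs_sub_le (w x) (w x') (w y), abs_sub_le (w x') (w y') (w y),
      abs_sub_comm (w y') (w y)]
  linarith

lemma exists_holder (h : ReciprocalExponents Λ P s R) {D : ℝ}
    (hD : ∀ x y : X, dist x y ≤ D) {K₀ : ℝ} (hK₀ : 0 < K₀) (k₀ : ℕ) {β₀ : ℝ} (h₀ : 0 < β₀)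
    (hβ : ∀ x, P x - s x * R x ≤ -β₀) :
    ∃ C : ℝ, 0 < C ∧ ∀ (E : ℕ → Set X) (w : X → ℝ), IsLevelFamily P s R K₀ k₀ E w →
      ∀ (k : ℕ) (x y : X), x ∈ E k → y ∈ E k →
      |w x - w y| ≤ C * dist x y ^ (s x - P x / R x) := by
  set K := max 1 |D| * 2 ^ (k₀ * Λ)
  have hK : 1 ≤ K := one_le_mul_of_one_le_of_one_le (le_max_left _ _)
    (Real.one_le_rpow one_le_two (mul_nonneg (Nat.cast_nonneg k₀) h.pos.le))
  obtain ⟨C, hC, hosc⟩ := h.exists_osc_le_of_neg (zero_le_one.trans hK) hK₀ h₀ hβ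
  refine ⟨C * 2 ^ (Λ * Λ), by positivity, fun E w hE k x y hx hy => ?_⟩
  rcases eq_or_ne x y with rfl | hne
  · rw [sub_self, abs_zero]
    positivity
  have hR := h.R_pos x
  obtain ⟨j, hj, hj_le, hle_j⟩ := exists_stopping_scale k₀ hR (dist_pos.2 hne) hK
    (h.le_mul_two_rpow (by positivity)
      ((hD x y).trans ((le_abs_self D).trans (le_max_right _ _))) k₀ x)
  have hα : s x - P x / R x = -(P x - s x * R x) / R x := by
    field_simp
    ring
  have hα_nonneg : 0 ≤ s x - P x / R x := by
    rw [hα]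
    exact div_nonneg (by linarith [hβ x]) hR.le
  calc |w x - w y| ≤ C * (2 : ℝ) ^ (j * (P x - s x * R x)) := hosc k₀ E w hE j k x y hj hx hy hle_j
    _ ≤ C * (2 : ℝ) ^ (Λ * Λ + (j + 1 : ℕ) * (P x - s x * R x)) := by
        gcongr
        · exact one_le_two
        · push_cast
          linarith [h.neg_le_gap x]
    _ = C * 2 ^ (Λ * Λ) * ((2 : ℝ) ^ (-((j + 1 : ℕ) * R x))) ^ (s x - P x / R x) := by
        rw [Real.rpow_add two_pos, ← mul_assoc, ← Real.rpow_mul two_pos.le, hα]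
        congr 2
        field_simp
    _ ≤ C * 2 ^ (Λ * Λ) * dist x y ^ (s x - P x / R x) := by gcongr

end ReciprocalExponents

end Chaining

section MetricMeasure

variable {X : Type*} [MetricSpace X] [MeasurableSpace X] {μ : Measure X}

lemma IsMetricMeasure.isOpenPosMeasure (hμ : IsMetricMeasure μ) : μ.IsOpenPosMeasure := by
  refine ⟨fun U hU ⟨x, hx⟩ hU₀ => ?_⟩
  obtain ⟨r, hr, hrU⟩ := Metric.isOpen_iff.1 hU x hx
  exact (hμ x r hr).1.ne' (measure_mono_null hrU hU₀)

lemma IsMetricMeasure.le_of_ae_le (hμ : IsMetricMeasure μ) {f g : X → ℝ} (hf : Continuous f)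
    (hg : Continuous g) (h : ∀ᵐ x ∂μ, f x ≤ g x) (x : X) : f x ≤ g x := by
  have := hμ.isOpenPosMeasure
  have hdense : Dense {x | f x ≤ g x} := Measure.dense_of_ae h
  have huniv := (isClosed_le hf hg).closure_eq.symm.trans hdense.closure_eq
  exact (huniv ▸ mem_univ x : x ∈ {x | f x ≤ g x})

lemma IsMetricMeasure.univ_lt_top (hμ : IsMetricMeasure μ)
    (hX : Bornology.IsBounded (univ : Set X)) : μ univ < ∞ := by
  cases isEmpty_or_nonempty X with
  | inl _ => simp [univ_eq_empty_iff.2 ‹_›]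
  | inr hne =>
    obtain ⟨x⟩ := hne
    obtain ⟨r, hr, h⟩ := hX.subset_ball_lt 0 x
    exact (measure_mono h).trans_lt (hμ x r hr).2

lemma LowerMeasureBound.exists_mem_dist_le {b δ : ℝ} {Q : X → ℝ} (hμ : LowerMeasureBound μ b δ Q)
    {E : Set X} {x : X} {r : ℝ} (hr : 0 < r) (hrδ : r ≤ δ)
    (hE : μ Eᶜ < ENNReal.ofReal (b * r ^ Q x)) : ∃ y ∈ E, dist x y ≤ r := by
  by_contra! hfar
  have hsub : Metric.ball x r ⊆ Eᶜ := fun y hy hyE =>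
    (hfar y hyE).not_gt (by rw [dist_comm]; exact hy)
  exact ((hμ x r hr hrδ).trans (measure_mono hsub)).not_gt hE

namespace IsBddLogExponent

variable {p : X → ℝ}

lemma dyadicLogHolder_inv (hp : IsBddLogExponent μ p) {Λ : ℝ} (hΛ : 0 < Λ) :
    DyadicLogHolder Λ (fun x => (p x)⁻¹) := by
  simpa only [one_div] using LogHolder.dyadicLogHolder hΛ hp.log

lemma continuous (hp : IsBddLogExponent μ p) : Continuous p :=
  ((hp.dyadicLogHolder_inv one_pos).continuous.inv₀
    (fun x => (inv_pos.2 (hp.bdd.pos x)).ne')).congr fun x => inv_inv (p x)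

lemma exists_forall_mem_Icc (hp : IsBddLogExponent μ p) (hμ : IsMetricMeasure μ) :
    ∃ B : ℝ, 1 ≤ B ∧ ∀ x, p x ∈ Icc B⁻¹ B := by
  obtain ⟨a, ha, hlower⟩ := hp.bdd.ess_lower
  obtain ⟨c, hupper⟩ := hp.bdd.ess_upper
  refine ⟨max 1 (max c a⁻¹), le_max_left _ _, fun x => ⟨?_, ?_⟩⟩
  · exact (inv_le_of_inv_le₀ ha ((le_max_right c a⁻¹).trans (le_max_right _ _))).trans
      (hμ.le_of_ae_le continuous_const hp.continuous hlower x)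
  · exact (hμ.le_of_ae_le hp.continuous continuous_const hupper x).trans
      ((le_max_left c a⁻¹).trans (le_max_right _ _))

end IsBddLogExponent

lemma MuchLess.exists_forall (hμ : IsMetricMeasure μ) {f g : X → ℝ} (hf : Continuous f)
    (hg : Continuous g) (h : MuchLess μ f g) : ∃ a : ℝ, 0 < a ∧ ∀ x, a ≤ g x - f x := by
  obtain ⟨a, ha, hae⟩ := h
  exact ⟨a, ha, hμ.le_of_ae_le continuous_const (hg.sub hf) hae⟩

lemma inv_mem_Icc_inv {a B : ℝ} (hB : 0 < B) (ha : a ∈ Icc B⁻¹ B) : a⁻¹ ∈ Icc B⁻¹ B := by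
  have ha₀ : 0 < a := (inv_pos.2 hB).trans_le ha.1
  exact ⟨inv_anti₀ ha₀ ha.2, inv_le_of_inv_le₀ hB ha.1⟩

lemma Icc_inv_subset_Icc_inv {B Λ : ℝ} (hB : 0 < B) (h : B ≤ Λ) : Icc B⁻¹ B ⊆ Icc Λ⁻¹ Λ :=
  Icc_subset_Icc (inv_anti₀ hB h) h

lemma Setting.exists_reciprocalExponents {b δ : ℝ} {Q p s : X → ℝ} (h : Setting μ b δ Q p s) :
    ∃ Λ : ℝ, ReciprocalExponents Λ (fun x => (p x)⁻¹) s (fun x => (Q x)⁻¹) := by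
  obtain ⟨B₁, hB₁, hp⟩ := h.p_log.exists_forall_mem_Icc h.metricMeasure
  obtain ⟨B₂, hB₂, hs⟩ := h.s_log.exists_forall_mem_Icc h.metricMeasure
  obtain ⟨B₃, hB₃, hQ⟩ := h.Q_log.exists_forall_mem_Icc h.metricMeasure
  set Λ := max B₁ (max B₂ B₃)
  have hΛ : 1 ≤ Λ := hB₁.trans (le_max_left _ _)
  have hΛ₀ : 0 < Λ := zero_lt_one.trans_le hΛ
  have hp' : ∀ x, p x ∈ Icc Λ⁻¹ Λ := fun x =>
    Icc_inv_subset_Icc_inv (one_pos.trans_le hB₁) (le_max_left _ _) (hp x)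
  have hs' : ∀ x, s x ∈ Icc Λ⁻¹ Λ := fun x => Icc_inv_subset_Icc_inv (one_pos.trans_le hB₂)
    ((le_max_left B₂ B₃).trans (le_max_right _ _)) (hs x)
  have hQ' : ∀ x, Q x ∈ Icc Λ⁻¹ Λ := fun x => Icc_inv_subset_Icc_inv (one_pos.trans_le hB₃)
    ((le_max_right B₂ B₃).trans (le_max_right _ _)) (hQ x)
  refine ⟨Λ, hΛ, fun x => inv_mem_Icc_inv hΛ₀ (hp' x), hs', fun x => inv_mem_Icc_inv hΛ₀ (hQ' x),
    h.p_log.dyadicLogHolder_inv hΛ₀, ?_, h.Q_log.dyadicLogHolder_inv hΛ₀⟩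
  have hs_inv := (h.s_log.dyadicLogHolder_inv hΛ₀).inv
    (fun x => inv_pos.2 (h.s_log.bdd.pos x)) (fun x => (inv_inv (s x)).trans_le (hs' x).2)
  simpa only [inv_inv] using hs_inv

end MetricMeasure

section LevelSets

variable {X : Type*}

/-- The part of the complement of `N` where `H ≤ 2 ^ k`. -/
def levelSet (N : Set X) (H : X → ℝ≥0∞) (k : ℕ) : Set X := {x | x ∉ N ∧ H x ≤ 2 ^ k}

lemma levelSet_monotone (N : Set X) (H : X → ℝ≥0∞) : Monotone (levelSet N H) :=
  fun _ _ hij _ hx => ⟨hx.1, hx.2.trans (pow_le_pow_right₀ one_le_two hij)⟩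

lemma toReal_le_of_mem_levelSet {N : Set X} {H : X → ℝ≥0∞} {k : ℕ} {x : X}
    (hx : x ∈ levelSet N H k) : (H x).toReal ≤ 2 ^ k := by
  simpa using ENNReal.toReal_mono (by simp) hx.2

lemma exists_mem_levelSet {N : Set X} {H : X → ℝ≥0∞} {x : X} (hx : x ∉ N) (hH : H x ≠ ∞)
    (k₀ : ℕ) : ∃ k, k₀ ≤ k ∧ x ∈ levelSet N H k ∧
      (2 : ℝ) ^ k ≤ 2 ^ (k₀ + 1) * (1 + (H x).toReal) := by
  obtain ⟨n, hn, hn'⟩ := exists_nat_pow_near (x := 1 + (H x).toReal)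
    (le_add_of_nonneg_right ENNReal.toReal_nonneg) (one_lt_two (α := ℝ))
  refine ⟨n + 1 + k₀, by omega, ⟨hx, ?_⟩, ?_⟩
  · rw [← ENNReal.toReal_le_toReal hH (by simp), ENNReal.toReal_pow, ENNReal.toReal_ofNat]
    calc (H x).toReal ≤ 1 + (H x).toReal := le_add_of_nonneg_left zero_le_one
      _ ≤ 2 ^ (n + 1) := hn'.le
      _ ≤ 2 ^ (n + 1 + k₀) := pow_le_pow_right₀ one_le_two (Nat.le_add_right _ _)
  · calc (2 : ℝ) ^ (n + 1 + k₀) = 2 ^ (k₀ + 1) * 2 ^ n := by ring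
      _ ≤ 2 ^ (k₀ + 1) * (1 + (H x).toReal) := by gcongr

lemma measure_compl_levelSet_le [MeasurableSpace X] {μ : Measure X} {N : Set X} {H : X → ℝ≥0∞}
    (hN : μ N = 0) (hH : Measurable H) (k : ℕ) :
    μ (levelSet N H k)ᶜ ≤ (∫⁻ x, H x ∂μ) / 2 ^ k := by
  have hsub : (levelSet N H k)ᶜ ⊆ N ∪ {x | 2 ^ k ≤ H x} := fun x hx =>
    or_iff_not_imp_left.2 fun hxN => le_of_not_ge fun hle => hx ⟨hxN, hle⟩
  calc μ (levelSet N H k)ᶜ ≤ μ N + μ {x | 2 ^ k ≤ H x} :=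
        (measure_mono hsub).trans (measure_union_le _ _)
    _ = μ {x | 2 ^ k ≤ H x} := by rw [hN, zero_add]
    _ ≤ (∫⁻ x, H x ∂μ) / 2 ^ k := meas_ge_le_lintegral_div hH.aemeasurable (by simp) (by simp)

lemma three_div_two_pow_le {b Λ Q : ℝ} (hb : 0 < b) (hQ : 0 < Q) (hQΛ : Q⁻¹ ≤ Λ) (k : ℕ) :
    3 / 2 ^ k ≤ b * (max 1 (3 / b) ^ Λ * (2 : ℝ) ^ (-(k * Q⁻¹))) ^ Q := by
  have hone : 1 ≤ Λ * Q := (inv_le_iff_one_le_mul₀ hQ).1 hQΛ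
  have hexp : -(k * Q⁻¹) * Q = -k := by field_simp
  have hbase : 3 / b ≤ max 1 (3 / b) ^ (Λ * Q) :=
    (le_max_right _ _).trans (Real.self_le_rpow_of_one_le (le_max_left _ _) hone)
  rw [Real.mul_rpow (by positivity) (by positivity), ← Real.rpow_mul (by positivity),
    ← Real.rpow_mul two_pos.le, hexp, Real.rpow_neg two_pos.le, Real.rpow_natCast]
  calc (3 : ℝ) / 2 ^ k = b * (3 / b * (2 ^ k)⁻¹) := by field_simp
    _ ≤ b * (max 1 (3 / b) ^ (Λ * Q) * (2 ^ k)⁻¹) := by gcongr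

variable [MetricSpace X]

lemma ReciprocalExponents.exists_forall_mul_two_rpow_le {Λ : ℝ} {P s R : X → ℝ}
    (h : ReciprocalExponents Λ P s R) {K δ : ℝ} (hK : 0 ≤ K) (hδ : 0 < δ) :
    ∃ k₀ : ℕ, ∀ k, k₀ ≤ k → ∀ x, K * (2 : ℝ) ^ (-(k * R x)) ≤ δ := by
  have hlim : Filter.Tendsto (fun k : ℕ => K * ((2 : ℝ) ^ (-Λ⁻¹)) ^ k) Filter.atTop
      (nhds (K * 0)) :=
    (tendsto_pow_atTop_nhds_zero_of_lt_one (by positivity)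
      (sub_pos.1 (one_sub_two_rpow_neg_pos (inv_pos.2 h.pos)))).const_mul K
  rw [mul_zero] at hlim
  obtain ⟨k₀, hk₀⟩ := Filter.eventually_atTop.1 (hlim.eventually_lt_const hδ)
  refine ⟨k₀, fun k hk x => (h.le_mul_two_rpow_of_le hK le_rfl).trans (le_trans ?_ (hk₀ k hk).le)⟩
  rw [← Real.rpow_natCast, ← Real.rpow_mul two_pos.le]
  apply le_of_eq
  ring_nf

/-- Outside of the null set `N`, the function `H ^ (1 / p)` is a Hajłasz gradient of `w`, and
`∫ H ≤ 2`: this is the normalised form in which gradients enter the chaining argument. The bound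
`2` rather than `1` leaves room for adding `|w| ^ p` to `H`. -/
structure HasHajlaszPower [MeasurableSpace X] (μ : Measure X) (p s : X → ℝ) (N : Set X)
    (H : X → ℝ≥0∞) (w : X → ℝ) : Prop where
  null : μ N = 0
  measurable : Measurable H
  lintegral_le : ∫⁻ x, H x ∂μ ≤ 2
  ne_top : ∀ x ∉ N, H x ≠ ∞
  osc : ∀ x ∉ N, ∀ y ∉ N, |w x - w y| ≤ dist x y ^ s x * (H x).toReal ^ (p x)⁻¹ +
    dist x y ^ s y * (H y).toReal ^ (p y)⁻¹

variable [MeasurableSpace X] {μ : Measure X} {p s Q : X → ℝ} {Λ b δ : ℝ} {N : Set X}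
  {H : X → ℝ≥0∞} {w : X → ℝ}

lemma HasHajlaszPower.abs_sub_le_of_mem_levelSet (hw : HasHajlaszPower μ p s N H w)
    (hp : ∀ x, 0 ≤ (p x)⁻¹) (k : ℕ) {x y : X} (hx : x ∈ levelSet N H k)
    (hy : y ∈ levelSet N H k) :
    |w x - w y| ≤ dist x y ^ s x * (2 : ℝ) ^ (k * (p x)⁻¹) +
      dist x y ^ s y * (2 : ℝ) ^ (k * (p y)⁻¹) := by
  have hpow : ∀ z ∈ levelSet N H k, (H z).toReal ^ (p z)⁻¹ ≤ (2 : ℝ) ^ (k * (p z)⁻¹) := by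
    intro z hz
    rw [Real.rpow_mul two_pos.le, Real.rpow_natCast]
    exact Real.rpow_le_rpow ENNReal.toReal_nonneg (toReal_le_of_mem_levelSet hz) (hp z)
  refine (hw.osc x hx.1 y hy.1).trans ?_
  gcongr
  exacts [hpow x hx, hpow y hy]

lemma HasHajlaszPower.exists_mem_levelSet_dist_le (hw : HasHajlaszPower μ p s N H w)
    (hμ : LowerMeasureBound μ b δ Q) (hb : 0 < b) {x : X} (hQ : 0 < Q x) (hQΛ : (Q x)⁻¹ ≤ Λ)
    {k : ℕ} (hk : max 1 (3 / b) ^ Λ * (2 : ℝ) ^ (-(k * (Q x)⁻¹)) ≤ δ) :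
    ∃ y ∈ levelSet N H k,
      dist x y ≤ max 1 (3 / b) ^ Λ * (2 : ℝ) ^ (-(k * (Q x)⁻¹)) := by
  refine hμ.exists_mem_dist_le (by positivity) hk ?_
  calc μ (levelSet N H k)ᶜ ≤ 2 / 2 ^ k :=
        (measure_compl_levelSet_le hw.null hw.measurable k).trans
          (by gcongr; exact hw.lintegral_le)
    _ = ENNReal.ofReal (2 / 2 ^ k) := by
        rw [ENNReal.ofReal_div_of_pos (by positivity), ENNReal.ofReal_pow two_pos.le,
          ENNReal.ofReal_ofNat]
    _ < ENNReal.ofReal (b * (max 1 (3 / b) ^ Λ * (2 : ℝ) ^ (-(k * (Q x)⁻¹))) ^ Q x) := by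
        rw [ENNReal.ofReal_lt_ofReal_iff_of_nonneg (by positivity)]
        refine lt_of_lt_of_le ?_ (three_div_two_pow_le hb hQ hQΛ k)
        gcongr
        norm_num

lemma ReciprocalExponents.exists_isLevelFamily
    (h : ReciprocalExponents Λ (fun x => (p x)⁻¹) s (fun x => (Q x)⁻¹)) (hb : 0 < b)
    (hδ : 0 < δ) :
    ∃ K₀ : ℝ, 0 < K₀ ∧ ∃ k₀ : ℕ, ∀ μ : Measure X, LowerMeasureBound μ b δ Q →
      ∀ (N : Set X) (H : X → ℝ≥0∞) (w : X → ℝ), HasHajlaszPower μ p s N H w →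
      IsLevelFamily (fun x => (p x)⁻¹) s (fun x => (Q x)⁻¹) K₀ k₀ (levelSet N H) w := by
  obtain ⟨k₀, hk₀⟩ := h.exists_forall_mul_two_rpow_le (K := max 1 (3 / b) ^ Λ) (by positivity) hδ
  refine ⟨max 1 (3 / b) ^ Λ, by positivity, k₀, fun μ hμ N H w hw =>
    ⟨levelSet_monotone N H, fun k hk x => ?_, fun k x hx y hy =>
      hw.abs_sub_le_of_mem_levelSet (fun z => (h.P_pos z).le) k hx hy⟩⟩
  exact hw.exists_mem_levelSet_dist_le hμ hb (inv_pos.1 (h.R_pos x)) (h.R_mem x).2 (hk₀ k hk x)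

end LevelSets

section Norms

variable {X : Type*}

lemma le_ellNorm {q : X → ℝ≥0∞} {x : X} (hq : 0 < q x) (g : ℤ → X → ℝ≥0∞) (k : ℤ) :
    g k x ≤ ellNorm q g x := by
  unfold ellNorm
  split_ifs with hq_top
  · exact le_iSup (fun k => g k x) k
  · rw [one_div, ENNReal.le_rpow_inv_iff (ENNReal.toReal_pos hq.ne' hq_top)]
    exact ENNReal.le_tsum (f := fun k => g k x ^ (q x).toReal) k

lemma div_mul_rpow_div_div_rpow_le {a t τ M : ℝ≥0∞} {e r : ℝ} (he : 0 ≤ e) (her : e ≤ r)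
    (hM : 1 ≤ M) (hM_top : M ≠ ∞) : a / (t * M ^ r) / (τ / M) ^ e ≤ a / t / τ ^ e := by
  have hM₀ : M ≠ 0 := (zero_lt_one.trans_le hM).ne'
  have hpow : (M ^ r)⁻¹ * M ^ e ≤ 1 := by
    rw [← ENNReal.div_eq_inv_mul]
    refine ENNReal.div_le_of_le_mul ?_
    rw [one_mul]
    exact ENNReal.rpow_le_rpow_of_exponent_le hM her
  have hr₀ : M ^ r ≠ 0 := (ENNReal.rpow_pos (pos_iff_ne_zero.2 hM₀) hM_top).ne'
  have hr_top : M ^ r ≠ ∞ := ENNReal.rpow_ne_top_of_nonneg (he.trans her) hM_top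
  have he₀ : M ^ e ≠ 0 := (ENNReal.rpow_pos (pos_iff_ne_zero.2 hM₀) hM_top).ne'
  have he_top : M ^ e ≠ ∞ := ENNReal.rpow_ne_top_of_nonneg he hM_top
  calc a / (t * M ^ r) / (τ / M) ^ e = a / t / τ ^ e * ((M ^ r)⁻¹ * M ^ e) := by
        rw [ENNReal.div_rpow_of_nonneg _ _ he, div_eq_mul_inv _ (τ ^ e / M ^ e),
          ENNReal.inv_div (.inl he_top) (.inl he₀), div_eq_mul_inv a,
          ENNReal.mul_inv (.inr hr_top) (.inr hr₀)]
        simp only [div_eq_mul_inv]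
        ring
    _ ≤ a / t / τ ^ e := mul_le_of_le_one_right' hpow

lemma toReal_inv_le_inv {c : ℝ} (hc : 0 < c) {q : ℝ≥0∞} (h : ENNReal.ofReal c ≤ q) :
    (q⁻¹).toReal ≤ c⁻¹ := by
  rw [← ENNReal.toReal_ofReal hc.le, ← ENNReal.toReal_inv]
  exact ENNReal.toReal_mono (ENNReal.inv_ne_top.2 (ENNReal.ofReal_pos.2 hc).ne')
    (ENNReal.inv_le_inv.2 h)

lemma inv_le_toReal_inv {c : ℝ} (hc : 0 ≤ c) {q : ℝ≥0∞} (hq : 0 < q)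
    (h : q ≤ ENNReal.ofReal c) : c⁻¹ ≤ (q⁻¹).toReal := by
  rw [← ENNReal.toReal_ofReal hc, ← ENNReal.toReal_inv]
  exact ENNReal.toReal_mono (ENNReal.inv_ne_top.2 hq.ne') (ENNReal.inv_le_inv.2 h)

variable [MeasurableSpace X] {μ : Measure X} {p : X → ℝ} {q : X → ℝ≥0∞}

lemma modular_mono (hp : ∀ x, 0 ≤ p x) {f g : X → ℝ≥0∞} (h : ∀ᵐ x ∂μ, f x ≤ g x) :
    modular μ p f ≤ modular μ p g :=
  lintegral_mono_ae (h.mono fun x hx => ENNReal.rpow_le_rpow hx (hp x))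

lemma modular_div_le (hp : ∀ x, 0 ≤ p x) {t M : ℝ≥0∞} (hM : M ≠ 0) (h : ∀ x, M ≤ t ^ p x)
    (f : X → ℝ≥0∞) : modular μ p (fun x => f x / t) ≤ modular μ p f / M := by
  unfold modular
  rw [div_eq_mul_inv, ← lintegral_mul_const' _ _ (ENNReal.inv_ne_top.2 hM)]
  refine lintegral_mono fun x => ?_
  rw [ENNReal.div_rpow_of_nonneg _ _ (hp x), div_eq_mul_inv]
  gcongr
  exact h x

lemma lpNorm_mono (hp : ∀ x, 0 ≤ p x) {f g : X → ℝ≥0∞} (h : ∀ᵐ x ∂μ, f x ≤ g x) :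
    lpNorm μ p f ≤ lpNorm μ p g :=
  sInf_le_sInf fun t ⟨ht₀, ht, hmod⟩ => ⟨ht₀, ht, (modular_mono hp
    (h.mono fun _ hx => by gcongr)).trans hmod⟩

lemma lpNorm_congr_ae {f g : X → ℝ≥0∞} (h : f =ᵐ[μ] g) : lpNorm μ p f = lpNorm μ p g := by
  have hmod : ∀ t, modular μ p (fun x => f x / t) = modular μ p (fun x => g x / t) := fun t =>
    lintegral_congr_ae (h.mono fun x hx => by simp only [hx])
  simp only [lpNorm, hmod]

lemma modular_div_le_one_of_lpNorm_lt (hp : ∀ x, 0 ≤ p x) {f : X → ℝ≥0∞} {t : ℝ≥0∞}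
    (h : lpNorm μ p f < t) : modular μ p (fun x => f x / t) ≤ 1 := by
  obtain ⟨t', ⟨-, -, hmod⟩, ht'⟩ := sInf_lt_iff.1 h
  exact (modular_mono hp (.of_forall fun x => by gcongr)).trans hmod

lemma lpNorm_lt_top {a : ℝ} (ha : 0 < a) (hp : ∀ x, a ≤ p x) {f : X → ℝ≥0∞}
    (hf : modular μ p f < ∞) : lpNorm μ p f < ∞ := by
  set M := max 1 (modular μ p f)
  have hM : 1 ≤ M := le_max_left _ _
  have hM_top : M ≠ ∞ := (max_lt ENNReal.one_lt_top hf).ne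
  have hM₀ : 0 < M := zero_lt_one.trans_le hM
  have hroot : M ^ a⁻¹ < ∞ := ENNReal.rpow_lt_top_of_nonneg (inv_nonneg.2 ha.le) hM_top
  suffices hmod : modular μ p (fun x => f x / M ^ a⁻¹) ≤ 1 by
    have hle : lpNorm μ p f ≤ M ^ a⁻¹ := sInf_le ⟨ENNReal.rpow_pos hM₀ hM_top, hroot, hmod⟩
    exact hle.trans_lt hroot
  have hpow : ∀ x, M ≤ (M ^ a⁻¹) ^ p x := fun x => by
    rw [← ENNReal.rpow_mul]
    refine ENNReal.le_rpow_self_of_one_le hM ?_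
    rw [inv_mul_eq_div]
    exact (one_le_div₀ ha).2 (hp x)
  calc modular μ p (fun x => f x / M ^ a⁻¹) ≤ modular μ p f / M :=
        modular_div_le (fun x => ha.le.trans (hp x)) hM₀.ne' hpow f
    _ ≤ 1 := ENNReal.div_le_of_le_mul (by rw [one_mul]; exact le_max_right _ _)

lemma modular_le_of_modular_div_rpow_le_one {τ : ℝ≥0∞} {e : X → ℝ} (hp : ∀ x, 0 < p x)
    (he : ∀ x, (p x)⁻¹ ≤ e x) (hτ₀ : τ ≠ 0) (hτ : τ ≤ 1) {f : X → ℝ≥0∞}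
    (h : modular μ p (fun x => f x / τ ^ e x) ≤ 1) : modular μ p f ≤ τ := by
  have hτ_top : τ ≠ ∞ := (hτ.trans_lt ENNReal.one_lt_top).ne
  have hpoint : ∀ x, f x ^ p x ≤ (f x / τ ^ e x) ^ p x * τ := fun x => by
    have hexp : 1 ≤ e x * p x := (inv_le_iff_one_le_mul₀ (hp x)).1 (he x)
    have hpow₀ : τ ^ (e x * p x) ≠ 0 := (ENNReal.rpow_pos (pos_iff_ne_zero.2 hτ₀) hτ_top).ne'
    rw [ENNReal.div_rpow_of_nonneg _ _ (hp x).le, ← ENNReal.rpow_mul, ENNReal.div_eq_inv_mul,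
      mul_right_comm, ← ENNReal.div_eq_inv_mul]
    refine le_mul_of_one_le_left' ?_
    rw [ENNReal.le_div_iff_mul_le (.inl hpow₀) (.inr hτ_top), one_mul]
    simpa only [ENNReal.rpow_one] using ENNReal.rpow_le_rpow_of_exponent_ge hτ hexp
  calc modular μ p f ≤ ∫⁻ x, (f x / τ ^ e x) ^ p x * τ ∂μ := lintegral_mono hpoint
    _ = modular μ p (fun x => f x / τ ^ e x) * τ := lintegral_mul_const' _ _ hτ_top
    _ ≤ τ := mul_le_of_le_one_left' h

/-- The contribution of a single function to `besovModular`; in the notation of the paper it is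
the quasi-norm of `|f| ^ q` in `L ^ (p / q)`. -/
noncomputable def besovTerm (μ : Measure X) (p : X → ℝ) (q : X → ℝ≥0∞) (f : X → ℝ≥0∞) : ℝ≥0∞ :=
  sInf {t : ℝ≥0∞ | 0 < t ∧ t < ∞ ∧ modular μ p (fun x => f x / t ^ ((q x)⁻¹).toReal) ≤ 1}

lemma besovModular_eq_tsum (g : ℤ → X → ℝ≥0∞) :
    besovModular μ p q g = ∑' k, besovTerm μ p q (g k) := rfl

lemma besovTerm_div_le (hp : ∀ x, 0 ≤ p x) {c : ℝ} (hc : 0 < c)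
    (hq : ∀ᵐ x ∂μ, ENNReal.ofReal c ≤ q x) {M : ℝ≥0∞} (hM : 1 ≤ M) (hM_top : M ≠ ∞) (t : ℝ≥0∞)
    (f : X → ℝ≥0∞) : besovTerm μ p q (fun x => f x / (t * M ^ c⁻¹)) ≤
      besovTerm μ p q (fun x => f x / t) / M := by
  have hM₀ : M ≠ 0 := (zero_lt_one.trans_le hM).ne'
  rw [ENNReal.le_div_iff_mul_le (.inl hM₀) (.inl hM_top)]
  refine le_sInf fun τ ⟨hτ₀, hτ, hmod⟩ => ?_
  rw [← ENNReal.le_div_iff_mul_le (.inl hM₀) (.inl hM_top)]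
  refine sInf_le ⟨ENNReal.div_pos hτ₀.ne' hM_top, ENNReal.div_lt_top hτ.ne hM₀, ?_⟩
  refine (modular_mono hp ?_).trans hmod
  filter_upwards [hq] with x hx
  exact div_mul_rpow_div_div_rpow_le ENNReal.toReal_nonneg (toReal_inv_le_inv hc hx) hM hM_top

lemma besovModular_div_le (hp : ∀ x, 0 ≤ p x) {c : ℝ} (hc : 0 < c)
    (hq : ∀ᵐ x ∂μ, ENNReal.ofReal c ≤ q x) {M : ℝ≥0∞} (hM : 1 ≤ M) (hM_top : M ≠ ∞) (t : ℝ≥0∞)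
    (g : ℤ → X → ℝ≥0∞) : besovModular μ p q (fun k x => g k x / (t * M ^ c⁻¹)) ≤
      besovModular μ p q (fun k x => g k x / t) / M := by
  rw [besovModular_eq_tsum, besovModular_eq_tsum, div_eq_mul_inv, ← ENNReal.tsum_mul_right]
  exact ENNReal.tsum_le_tsum fun k => besovTerm_div_le hp hc hq hM hM_top t (g k)

lemma IsVarExponent.exists_lower (hq : IsVarExponent μ q) :
    ∃ c : ℝ, 0 < c ∧ ∀ᵐ x ∂μ, ENNReal.ofReal c ≤ q x := by
  have hm : min 1 (essInf q μ) ≠ ∞ := (min_lt_of_left_lt ENNReal.one_lt_top).ne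
  refine ⟨(min 1 (essInf q μ)).toReal,
    ENNReal.toReal_pos (lt_min zero_lt_one hq.essInf_pos).ne' hm, ?_⟩
  filter_upwards [ae_essInf_le (f := q) (μ := μ)] with x hx
  rw [ENNReal.ofReal_toReal hm]
  exact (min_le_right _ _).trans hx

lemma mixedNorm_besov_lt_top (hp : ∀ x, 0 ≤ p x) (hq : IsVarExponent μ q) {g : ℤ → X → ℝ≥0∞}
    {t : ℝ≥0∞} (ht₀ : 0 < t) (ht : t < ∞)
    (h : besovModular μ p q (fun k x => g k x / t) < ∞) : mixedNorm .besov μ p q g < ∞ := by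
  obtain ⟨c, hc, hqc⟩ := hq.exists_lower
  set M := max 1 (besovModular μ p q (fun k x => g k x / t))
  have hM : 1 ≤ M := le_max_left _ _
  have hM_top : M ≠ ∞ := (max_lt ENNReal.one_lt_top h).ne
  have hroot₀ : M ^ c⁻¹ ≠ 0 := (ENNReal.rpow_pos (zero_lt_one.trans_le hM) hM_top).ne'
  have hroot : M ^ c⁻¹ ≠ ∞ := ENNReal.rpow_ne_top_of_nonneg (inv_nonneg.2 hc.le) hM_top
  have hT : t * M ^ c⁻¹ < ∞ := (ENNReal.mul_ne_top ht.ne hroot).lt_top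
  suffices hmod : besovModular μ p q (fun k x => g k x / (t * M ^ c⁻¹)) ≤ 1 by
    have hle : mixedNorm .besov μ p q g ≤ t * M ^ c⁻¹ :=
      sInf_le ⟨pos_iff_ne_zero.2 (mul_ne_zero ht₀.ne' hroot₀), hT, hmod⟩
    exact hle.trans_lt hT
  calc besovModular μ p q (fun k x => g k x / (t * M ^ c⁻¹))
      ≤ besovModular μ p q (fun k x => g k x / t) / M :=
        besovModular_div_le hp hc hqc hM hM_top t g
    _ ≤ 1 := ENNReal.div_le_of_le_mul (by rw [one_mul]; exact le_max_right _ _)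

lemma mixedNorm_lt_top {a : ℝ} (ha : 0 < a) (hp : ∀ x, a ≤ p x) {A : Scale}
    (hq : IsVarExponent μ q) {g : ℤ → X → ℝ≥0∞} (hg : MemMixed A μ p q g) :
    mixedNorm A μ p q g < ∞ := by
  cases A with
  | triebelLizorkin => exact lpNorm_lt_top ha hp hg.2.2
  | besov =>
    obtain ⟨-, t, ht₀, ht, hmod⟩ := hg
    exact mixedNorm_besov_lt_top (fun x => ha.le.trans (hp x)) hq ht₀ ht hmod

lemma besovModular_div_lt_one (hp : ∀ x, 0 ≤ p x) (hq : IsVarExponent μ q) {g : ℤ → X → ℝ≥0∞}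
    {T : ℝ≥0∞} (hT : T ≠ ∞) (h : mixedNorm .besov μ p q g < T) :
    besovModular μ p q (fun k x => g k x / T) < 1 := by
  obtain ⟨c, hc, hqc⟩ := hq.exists_lower
  obtain ⟨t, ⟨ht₀, ht, hmod⟩, htT⟩ := sInf_lt_iff.1 h
  have hratio : 1 < T / t := by
    rwa [ENNReal.lt_div_iff_mul_lt (.inl ht₀.ne') (.inl ht.ne), one_mul]
  have hM : 1 < (T / t) ^ c := ENNReal.one_lt_rpow hratio hc
  have hM_top : (T / t) ^ c ≠ ∞ :=
    ENNReal.rpow_ne_top_of_nonneg hc.le (ENNReal.div_lt_top hT ht₀.ne').ne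
  calc besovModular μ p q (fun k x => g k x / T)
      = besovModular μ p q (fun k x => g k x / (t * ((T / t) ^ c) ^ c⁻¹)) := by
        rw [ENNReal.rpow_rpow_inv hc.ne', ENNReal.mul_div_cancel ht₀.ne' ht.ne]
    _ ≤ besovModular μ p q (fun k x => g k x / t) / (T / t) ^ c :=
        besovModular_div_le hp hc hqc hM.le hM_top t g
    _ ≤ 1 / (T / t) ^ c := by gcongr
    _ < 1 := by rw [one_div]; exact ENNReal.inv_lt_one.2 hM

lemma modular_le_besovTerm (hp : ∀ x, 0 < p x) (hq : ∀ x, (p x)⁻¹ ≤ ((q x)⁻¹).toReal)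
    {f : X → ℝ≥0∞} (h : besovTerm μ p q f < 1) : modular μ p f ≤ besovTerm μ p q f := by
  obtain ⟨σ, ⟨hσ₀, -, hσ_mod⟩, hσ⟩ := sInf_lt_iff.1 h
  refine le_sInf fun τ ⟨hτ₀, _, hτ_mod⟩ => ?_
  rcases le_total τ 1 with hτ | hτ
  · exact modular_le_of_modular_div_rpow_le_one hp hq hτ₀.ne' hτ hτ_mod
  · exact (modular_le_of_modular_div_rpow_le_one hp hq hσ₀.ne' hσ.le hσ_mod).trans
      (hσ.le.trans hτ)

lemma modular_iSup_le_tsum {ι : Type*} [Countable ι] (hp : ∀ x, 0 < p x) (hp_meas : Measurable p)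
    {g : ι → X → ℝ≥0∞} (hg : ∀ k, Measurable (g k)) :
    modular μ p (fun x => ⨆ k, g k x) ≤ ∑' k, modular μ p (g k) := by
  have hpoint : ∀ x, (⨆ k, g k x) ^ p x ≤ ∑' k, g k x ^ p x := fun x => by
    rw [← ENNReal.le_rpow_inv_iff (hp x)]
    exact iSup_le fun k => (ENNReal.le_rpow_inv_iff (hp x)).2
      (ENNReal.le_tsum (f := fun k => g k x ^ p x) k)
  calc modular μ p (fun x => ⨆ k, g k x) ≤ ∫⁻ x, ∑' k, g k x ^ p x ∂μ := lintegral_mono hpoint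
    _ = ∑' k, modular μ p (g k) :=
      lintegral_tsum fun k => ((hg k).pow hp_meas).aemeasurable

lemma lpNorm_iSup_le_mixedNorm_besov (hp : ∀ x, 0 < p x) (hp_meas : Measurable p)
    (hq : IsVarExponent μ q) (hqp : ∀ x, q x ≤ ENNReal.ofReal (p x)) {g : ℤ → X → ℝ≥0∞}
    (hg : ∀ k, Measurable (g k)) :
    lpNorm μ p (fun x => ⨆ k, g k x) ≤ mixedNorm .besov μ p q g := by
  refine le_of_forall_gt_imp_ge_of_dense fun T hT => ?_
  rcases eq_or_ne T ∞ with rfl | hT_top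
  · exact le_top
  have hlt := besovModular_div_lt_one (fun x => (hp x).le) hq hT_top hT
  have hterm : ∀ k, modular μ p (fun x => g k x / T) ≤ besovTerm μ p q (fun x => g k x / T) :=
    fun k => modular_le_besovTerm hp
      (fun x => inv_le_toReal_inv (hp x).le (hq.pos x) (hqp x))
      ((ENNReal.le_tsum k).trans_lt hlt)
  refine sInf_le ⟨zero_le.trans_lt hT, hT_top.lt_top, ?_⟩
  calc modular μ p (fun x => (⨆ k, g k x) / T) = modular μ p (fun x => ⨆ k, g k x / T) := by
        simp only [ENNReal.iSup_div]
    _ ≤ ∑' k, modular μ p (fun x => g k x / T) :=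
        modular_iSup_le_tsum hp hp_meas fun k => (hg k).div_const T
    _ ≤ besovModular μ p q (fun k x => g k x / T) := ENNReal.tsum_le_tsum hterm
    _ ≤ 1 := hlt.le

lemma lpNorm_iSup_le_mixedNorm (hp : ∀ x, 0 < p x) (hp_meas : Measurable p) {A : Scale}
    (hq : AdmissibleExponent A μ p q) {g : ℤ → X → ℝ≥0∞} (hg : ∀ k, Measurable (g k)) :
    lpNorm μ p (fun x => ⨆ k, g k x) ≤ mixedNorm A μ p q g := by
  cases A with
  | triebelLizorkin =>
    exact lpNorm_mono (fun x => (hp x).le)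
      (.of_forall fun x => iSup_le fun k => le_ellNorm (hq.1.pos x) g k)
  | besov => exact lpNorm_iSup_le_mixedNorm_besov hp hp_meas hq.1 (hq.2 rfl) hg

end Norms

section FiniteValues

variable {X : Type*} [MeasurableSpace X] {μ : Measure X} {p : X → ℝ} {u : X → EReal}

lemma ereal_abs_sub_of_finite {a b : EReal} (ha : a ≠ ⊤ ∧ a ≠ ⊥) (hb : b ≠ ⊤ ∧ b ≠ ⊥) :
    (a - b).abs = ENNReal.ofReal |a.toReal - b.toReal| := by
  lift a to ℝ using ha
  lift b to ℝ using hb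
  rw [← EReal.coe_sub, EReal.abs_def, EReal.toReal_coe, EReal.toReal_coe]

lemma lpNorm_abs_sub_coe (hu : ∀ᵐ x ∂μ, u x ≠ ⊤ ∧ u x ≠ ⊥) (c : ℝ) :
    lpNorm μ p (fun x => (u x - (c : EReal)).abs) =
      lpNorm μ p (fun x => ENNReal.ofReal |(u x).toReal - c|) :=
  lpNorm_congr_ae (hu.mono fun _ hx => ereal_abs_sub_of_finite hx (by simp))

lemma lpNorm_abs_toReal (hu : ∀ᵐ x ∂μ, u x ≠ ⊤ ∧ u x ≠ ⊥) :
    lpNorm μ p (fun x => (u x).abs) = lpNorm μ p (fun x => ENNReal.ofReal |(u x).toReal|) := by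
  simpa using lpNorm_abs_sub_coe hu 0

end FiniteValues

section HajlaszGradients

variable {X : Type*} [MetricSpace X] [MeasurableSpace X] {μ : Measure X} {p s : X → ℝ}
  {w : X → ℝ} {G F : X → ℝ≥0∞} {u : X → EReal} {g : ℤ → X → ℝ≥0∞}

/-- `G` is a (scalar) `s(·)`-Hajłasz gradient of `w`. In contrast with a vector gradient, a single
function serves all scales of `dist x y`. -/
structure IsHajlaszGradient (μ : Measure X) (s w : X → ℝ) (G : X → ℝ≥0∞) : Prop where
  measurable : Measurable G
  exists_null : ∃ N : Set X, μ N = 0 ∧ ∀ x ∉ N, ∀ y ∉ N, ENNReal.ofReal |w x - w y| ≤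
    ENNReal.ofReal (dist x y ^ s x) * G x + ENNReal.ofReal (dist x y ^ s y) * G y

lemma IsVectorGradient.isHajlaszGradient_iSup (hg : IsVectorGradient μ s u g)
    (hu : ∀ᵐ x ∂μ, u x ≠ ⊤ ∧ u x ≠ ⊥) :
    IsHajlaszGradient μ s (fun x => (u x).toReal) (fun x => ⨆ k, g k x) := by
  obtain ⟨hg_meas, N, hN, hgrad⟩ := hg
  refine ⟨.iSup hg_meas, N ∪ {x | ¬(u x ≠ ⊤ ∧ u x ≠ ⊥)},
    measure_union_null hN (ae_iff.1 hu), fun x hx y hy => ?_⟩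
  simp only [mem_union, mem_ofPred_eq, not_or, not_not] at hx hy
  obtain rfl | hxy := eq_or_ne x y
  · simp
  obtain ⟨n, hn, hn'⟩ := exists_mem_Ico_zpow (dist_pos.2 hxy) (one_lt_two (α := ℝ))
  rw [← ereal_abs_sub_of_finite hx.2 hy.2]
  refine (hgrad (-n - 1) x y hx.1 hy.1 (by simpa using hn) (by simpa [add_comm] using hn')).trans ?_
  gcongr
  exacts [le_iSup (fun k => g k x) _, le_iSup (fun k => g k y) _]

lemma le_ofReal_mul_toReal_rpow_inv {a c : ℝ≥0∞} {r t : ℝ} (hr : 0 < r) (ht : 0 < t)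
    (hc : c ≠ ∞) (h : (a / ENNReal.ofReal t) ^ r ≤ c) :
    a ≤ ENNReal.ofReal (t * c.toReal ^ r⁻¹) := by
  rw [ENNReal.ofReal_mul ht.le, ← ENNReal.ofReal_rpow_of_nonneg ENNReal.toReal_nonneg
    (inv_nonneg.2 hr.le), ENNReal.ofReal_toReal hc, mul_comm,
    ← ENNReal.div_le_iff (ENNReal.ofReal_pos.2 ht).ne' ENNReal.ofReal_ne_top]
  exact (ENNReal.le_rpow_inv_iff hr).2 h

lemma IsHajlaszGradient.exists_hasHajlaszPower (hG : IsHajlaszGradient μ s w G)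
    (hp : ∀ x, 0 < p x) (hp_meas : Measurable p) {t : ℝ} (ht : 0 < t)
    (hGt : lpNorm μ p G < ENNReal.ofReal t) (hF_meas : Measurable F) (hF : ∫⁻ x, F x ∂μ ≤ 1) :
    ∃ (N : Set X) (H : X → ℝ≥0∞), HasHajlaszPower μ p s N H (fun x => w x / t) ∧
      ∀ x, F x ≤ H x := by
  obtain ⟨N, hN, hosc⟩ := hG.exists_null
  set H : X → ℝ≥0∞ := fun x => (G x / ENNReal.ofReal t) ^ p x + F x
  have hG_meas : Measurable fun x => (G x / ENNReal.ofReal t) ^ p x :=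
    (hG.measurable.div_const _).pow hp_meas
  have hH_meas : Measurable H := hG_meas.add hF_meas
  have hH : ∫⁻ x, H x ∂μ ≤ 2 := by
    rw [lintegral_add_left hG_meas, ← one_add_one_eq_two]
    exact add_le_add (modular_div_le_one_of_lpNorm_lt (fun x => (hp x).le) hGt) hF
  have hH_fin : ∀ᵐ x ∂μ, H x < ∞ := ae_lt_top hH_meas (hH.trans_lt (by simp)).ne
  refine ⟨N ∪ {x | ¬H x < ∞}, H, ⟨measure_union_null hN (ae_iff.1 hH_fin), hH_meas, hH,
    fun x hx => ?_, fun x hx y hy => ?_⟩, fun x => le_add_self⟩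
  · simp only [mem_union, mem_ofPred_eq, not_or, not_not] at hx
    exact hx.2.ne
  · simp only [mem_union, mem_ofPred_eq, not_or, not_not] at hx hy
    have hG_le : ∀ z, H z < ∞ → G z ≤ ENNReal.ofReal (t * (H z).toReal ^ (p z)⁻¹) := fun z hz =>
      le_ofReal_mul_toReal_rpow_inv (hp z) ht hz.ne le_self_add
    have hw : |w x - w y| ≤ t * (dist x y ^ s x * (H x).toReal ^ (p x)⁻¹ +
        dist x y ^ s y * (H y).toReal ^ (p y)⁻¹) := by
      rw [← ENNReal.ofReal_le_ofReal_iff (by positivity), mul_add, mul_left_comm t,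
        mul_left_comm t, ENNReal.ofReal_add (by positivity) (by positivity),
        ENNReal.ofReal_mul (p := dist x y ^ s x) (by positivity),
        ENNReal.ofReal_mul (p := dist x y ^ s y) (by positivity)]
      refine (hosc x hx.1 y hy.1).trans ?_
      gcongr
      exacts [hG_le x hx.2, hG_le y hy.2]
    rwa [← sub_div, abs_div, abs_of_pos ht, div_le_iff₀' ht]

lemma IsHajlaszGradient.exists_hasHajlaszPower_of_lpNorm_lt (hG : IsHajlaszGradient μ s w G)
    (hp : ∀ x, 0 < p x) (hp_meas : Measurable p) (hw_meas : Measurable w) {t : ℝ} (ht : 0 < t)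
    (hGt : lpNorm μ p G < ENNReal.ofReal t)
    (hwt : lpNorm μ p (fun x => ENNReal.ofReal |w x|) < ENNReal.ofReal t) :
    ∃ (N : Set X) (H : X → ℝ≥0∞), HasHajlaszPower μ p s N H (fun x => w x / t) ∧
      ∀ x ∉ N, |w x / t| ≤ (H x).toReal ^ (p x)⁻¹ := by
  obtain ⟨N, H, hH, hle⟩ := hG.exists_hasHajlaszPower hp hp_meas ht hGt
    (F := fun x => (ENNReal.ofReal |w x| / ENNReal.ofReal t) ^ p x)
    ((hw_meas.abs.ennreal_ofReal.div_const _).pow hp_meas)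
    (modular_div_le_one_of_lpNorm_lt (fun x => (hp x).le) hwt)
  refine ⟨N, H, hH, fun x hx => ?_⟩
  have hwx : |w x| ≤ t * (H x).toReal ^ (p x)⁻¹ := (ENNReal.ofReal_le_ofReal_iff
    (by positivity)).1 (le_ofReal_mul_toReal_rpow_inv (hp x) ht (hH.ne_top x hx) (hle x))
  rwa [abs_div, abs_of_pos ht, div_le_iff₀' ht]

end HajlaszGradients

section PointwiseEstimates

variable {X : Type*} [MetricSpace X] [MeasurableSpace X] {p s Q : X → ℝ} {Λ D b δ : ℝ}

lemma HasHajlaszPower.ae_notMem {μ : Measure X} {N : Set X} {H : X → ℝ≥0∞} {w : X → ℝ}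
    (hw : HasHajlaszPower μ p s N H w) : ∀ᵐ x ∂μ, x ∉ N :=
  measure_eq_zero_iff_ae_notMem.1 hw.null

lemma HasHajlaszPower.integrable {μ : Measure X} {N : Set X} {H : X → ℝ≥0∞} {w : X → ℝ}
    (hw : HasHajlaszPower μ p s N H w) : Integrable (fun x => (H x).toReal) μ :=
  integrable_toReal_of_lintegral_ne_top hw.measurable.aemeasurable
    (hw.lintegral_le.trans_lt (by simp)).ne

lemma HasHajlaszPower.integral_le {μ : Measure X} {N : Set X} {H : X → ℝ≥0∞} {w : X → ℝ}
    (hw : HasHajlaszPower μ p s N H w) : ∫ x, (H x).toReal ∂μ ≤ 2 := by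
  rw [integral_toReal hw.measurable.aemeasurable
    (ae_lt_top hw.measurable (hw.lintegral_le.trans_lt (by simp)).ne)]
  simpa using ENNReal.toReal_mono (by simp) hw.lintegral_le

namespace ReciprocalExponents

lemma exists_abs_sub_le_rpow [Nonempty X]
    (h : ReciprocalExponents Λ (fun x => (p x)⁻¹) s (fun x => (Q x)⁻¹))
    (hD : ∀ x y : X, dist x y ≤ D) (hb : 0 < b) (hδ : 0 < δ) {β₀ : ℝ} (h₀ : 0 < β₀)
    (hβ : ∀ x, β₀ ≤ (p x)⁻¹ - s x * (Q x)⁻¹) :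
    ∃ C : ℝ, 1 ≤ C ∧ ∀ μ : Measure X, LowerMeasureBound μ b δ Q →
      ∀ (N : Set X) (H : X → ℝ≥0∞) (w : X → ℝ), HasHajlaszPower μ p s N H w →
      ∃ z ∉ N, (H z).toReal ≤ C ∧ ∀ x ∉ N,
        |w x - w z| ≤ C * (1 + (H x).toReal) ^ ((p x)⁻¹ - s x * (Q x)⁻¹) := by
  obtain ⟨K₀, hK₀, k₀, hlevel⟩ := h.exists_isLevelFamily hb hδ
  obtain ⟨C, hC, hosc⟩ := h.exists_osc_le_of_pos hD hK₀ k₀ h₀ hβ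
  set B : ℝ := 2 ^ (k₀ + 1)
  have hB : 1 ≤ B := one_le_pow₀ one_le_two
  refine ⟨max (2 ^ k₀) (C * B ^ Λ), (one_le_pow₀ one_le_two).trans (le_max_left _ _),
    fun μ hμ N H w hw => ?_⟩
  have hE := hlevel μ hμ N H w hw
  obtain ⟨z, hz, -⟩ := hE.near k₀ le_rfl (Classical.arbitrary X)
  refine ⟨z, hz.1, (toReal_le_of_mem_levelSet hz).trans (le_max_left _ _), fun x hx => ?_⟩
  obtain ⟨k, hk, hxk, hkH⟩ := exists_mem_levelSet hx (hw.ne_top x hx) k₀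
  have hβx : 0 ≤ (p x)⁻¹ - s x * (Q x)⁻¹ := h₀.le.trans (hβ x)
  calc |w x - w z| ≤ C * (2 : ℝ) ^ (k * ((p x)⁻¹ - s x * (Q x)⁻¹)) := hosc _ w hE k x z hk hxk hz
    _ = C * ((2 : ℝ) ^ k) ^ ((p x)⁻¹ - s x * (Q x)⁻¹) := by
      rw [Real.rpow_mul two_pos.le, Real.rpow_natCast]
    _ ≤ C * (B * (1 + (H x).toReal)) ^ ((p x)⁻¹ - s x * (Q x)⁻¹) := by gcongr
    _ = C * B ^ ((p x)⁻¹ - s x * (Q x)⁻¹) * (1 + (H x).toReal) ^ ((p x)⁻¹ - s x * (Q x)⁻¹) := by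
      rw [Real.mul_rpow (by positivity) (by positivity), mul_assoc]
    _ ≤ max (2 ^ k₀) (C * B ^ Λ) * (1 + (H x).toReal) ^ ((p x)⁻¹ - s x * (Q x)⁻¹) := by
      gcongr
      refine le_trans ?_ (le_max_right _ _)
      gcongr
      exact h.gap_le x

lemma exists_abs_sub_le_log [Nonempty X]
    (h : ReciprocalExponents Λ (fun x => (p x)⁻¹) s (fun x => (Q x)⁻¹))
    (hD : ∀ x y : X, dist x y ≤ D) (hb : 0 < b) (hδ : 0 < δ)
    (hβ : ∀ x, (p x)⁻¹ - s x * (Q x)⁻¹ = 0) :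
    ∃ C : ℝ, 0 < C ∧ ∀ μ : Measure X, LowerMeasureBound μ b δ Q →
      ∀ (N : Set X) (H : X → ℝ≥0∞) (w : X → ℝ), HasHajlaszPower μ p s N H w →
      ∃ z, ∀ x ∉ N, |w x - w z| ≤ C * (1 + Real.log (1 + (H x).toReal)) := by
  obtain ⟨K₀, hK₀, k₀, hlevel⟩ := h.exists_isLevelFamily hb hδ
  obtain ⟨C, hC, hosc⟩ := h.exists_osc_le_of_eq_zero hD hK₀ k₀ hβ
  have hlog2 : 0 < Real.log 2 := Real.log_pos one_lt_two
  refine ⟨C * (k₀ + 2 + (Real.log 2)⁻¹), by positivity, fun μ hμ N H w hw => ?_⟩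
  have hE := hlevel μ hμ N H w hw
  obtain ⟨z, hz, -⟩ := hE.near k₀ le_rfl (Classical.arbitrary X)
  refine ⟨z, fun x hx => ?_⟩
  obtain ⟨k, hk, hxk, hkH⟩ := exists_mem_levelSet hx (hw.ne_top x hx) k₀
  have hlog : 0 ≤ Real.log (1 + (H x).toReal) :=
    Real.log_nonneg (le_add_of_nonneg_right ENNReal.toReal_nonneg)
  have hk_le : (k : ℝ) ≤ k₀ + 1 + (Real.log 2)⁻¹ * Real.log (1 + (H x).toReal) := by
    have hlog_le := Real.log_le_log (by positivity) hkH
    rw [Real.log_mul (by positivity) (by positivity), Real.log_pow, Real.log_pow] at hlog_le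
    rw [← mul_le_mul_iff_left₀ hlog2]
    calc k * Real.log 2 ≤ (k₀ + 1 : ℕ) * Real.log 2 + Real.log (1 + (H x).toReal) := hlog_le
      _ = _ := by push_cast; field_simp
  refine (hosc _ w hE k x z hk hxk hz).trans ?_
  rw [mul_assoc]
  gcongr
  have hk₀_log : 0 ≤ ((k₀ : ℝ) + 2) * Real.log (1 + (H x).toReal) := by positivity
  linarith [inv_pos.2 hlog2]

lemma exists_abs_sub_le_dist_rpow
    (h : ReciprocalExponents Λ (fun x => (p x)⁻¹) s (fun x => (Q x)⁻¹))
    (hD : ∀ x y : X, dist x y ≤ D) (hb : 0 < b) (hδ : 0 < δ) {β₀ : ℝ} (h₀ : 0 < β₀)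
    (hβ : ∀ x, (p x)⁻¹ - s x * (Q x)⁻¹ ≤ -β₀) :
    ∃ C : ℝ, 0 < C ∧ ∀ μ : Measure X, LowerMeasureBound μ b δ Q →
      ∀ (N : Set X) (H : X → ℝ≥0∞) (w : X → ℝ), HasHajlaszPower μ p s N H w →
      ∀ x ∉ N, ∀ y ∉ N, |w x - w y| ≤ C * dist x y ^ (s x - Q x / p x) := by
  obtain ⟨K₀, hK₀, k₀, hlevel⟩ := h.exists_isLevelFamily hb hδ
  obtain ⟨C, hC, hholder⟩ := h.exists_holder hD hK₀ k₀ h₀ hβ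
  refine ⟨C, hC, fun μ hμ N H w hw x hx y hy => ?_⟩
  have hE := hlevel μ hμ N H w hw
  obtain ⟨k, -, hxk, -⟩ := exists_mem_levelSet hx (hw.ne_top x hx) k₀
  obtain ⟨l, -, hyl, -⟩ := exists_mem_levelSet hy (hw.ne_top y hy) k₀
  simpa only [inv_div_inv] using hholder _ w hE (max k l) x y
    (hE.mono (le_max_left _ _) hxk) (hE.mono (le_max_right _ _) hyl)

end ReciprocalExponents

end PointwiseEstimates

section Integration

variable {X : Type*} [MeasurableSpace X] {μ : Measure X}

lemma le_mul_of_forall_lt {a n : ℝ≥0∞} {C : ℝ} (hC : 0 < C)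
    (h : ∀ t : ℝ, 0 < t → n < ENNReal.ofReal t → a ≤ ENNReal.ofReal (C * t)) :
    a ≤ ENNReal.ofReal C * n := by
  have hC_pos := ENNReal.ofReal_pos.2 hC
  rw [mul_comm, ← ENNReal.div_le_iff hC_pos.ne' ENNReal.ofReal_ne_top]
  refine le_of_forall_gt_imp_ge_of_dense fun t ht => ?_
  rcases eq_or_ne t ∞ with rfl | ht_top
  · exact le_top
  have hta := h t.toReal (ENNReal.toReal_pos (bot_le.trans_lt ht).ne' ht_top)
    (by rwa [ENNReal.ofReal_toReal ht_top])
  rwa [ENNReal.div_le_iff hC_pos.ne' ENNReal.ofReal_ne_top, mul_comm,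
    ← ENNReal.ofReal_toReal ht_top, ← ENNReal.ofReal_mul hC.le]

lemma exists_null_forall_le_of_forall_lt {f k : X → X → ℝ} {n : ℝ}
    (h : ∀ t, n < t → ∃ N : Set X, μ N = 0 ∧ ∀ x ∉ N, ∀ y ∉ N, f x y ≤ t * k x y) :
    ∃ N : Set X, μ N = 0 ∧ ∀ x ∉ N, ∀ y ∉ N, f x y ≤ n * k x y := by
  obtain ⟨t, -, ht, ht_lim⟩ := exists_seq_strictAnti_tendsto n
  choose N hN hf using fun j => h (t j) (ht j)
  refine ⟨⋃ j, N j, measure_iUnion_null hN, fun x hx y hy => ?_⟩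
  simp only [mem_iUnion, not_exists] at hx hy
  exact ge_of_tendsto' (ht_lim.mul_const _) fun j => hf j x (hx j) y (hy j)

lemma abs_sub_average_le [IsFiniteMeasure μ] [NeZero μ] {w F : X → ℝ} {a : ℝ}
    (hw : Integrable w μ) (hF : Integrable F μ) (h : ∀ᵐ x ∂μ, |w x - a| ≤ F x) :
    |a - ⨍ x, w x ∂μ| ≤ ⨍ x, F x ∂μ := by
  have hsub : ⨍ x, w x ∂μ - a = ⨍ x, (w x - a) ∂μ := by
    conv_lhs => rw [← average_const μ a]
    exact (integral_sub hw.to_average (integrable_const a)).symm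
  rw [abs_sub_comm, hsub, ← Real.norm_eq_abs]
  exact norm_integral_le_of_norm_le hF.to_average
    (Measure.ae_smul_measure h _)

lemma integrable_of_abs_sub_le [IsFiniteMeasure μ] {w F : X → ℝ} {a : ℝ}
    (hw : Measurable w) (hF : Integrable F μ) (h : ∀ᵐ x ∂μ, |w x - a| ≤ F x) :
    Integrable w μ := by
  have hsub : Integrable (fun x => w x - a) μ :=
    hF.mono' (hw.sub_const a).aestronglyMeasurable h
  simpa only [Pi.add_def, sub_add_cancel] using hsub.add (integrable_const a)

lemma integrable_and_ae_abs_sub_average_le [IsFiniteMeasure μ] [NeZero μ]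
    {w : X → ℝ} {N : Set X} {B : ℝ} (hw : Measurable w) (hN : μ N = 0)
    (h : ∀ x ∉ N, ∀ y ∉ N, |w x - w y| ≤ B) :
    Integrable w μ ∧ ∀ᵐ x ∂μ, |w x - ⨍ y, w y ∂μ| ≤ B := by
  have hae : ∀ᵐ x ∂μ, x ∉ N := measure_eq_zero_iff_ae_notMem.1 hN
  have hosc : ∀ x ∉ N, ∀ᵐ y ∂μ, |w y - w x| ≤ B := fun x hx =>
    hae.mono fun y hy => h y hy x hx
  obtain ⟨z, hz⟩ := hae.exists
  have hint : Integrable w μ := integrable_of_abs_sub_le hw (integrable_const B) (hosc z hz)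
  refine ⟨hint, hae.mono fun x hx => ?_⟩
  simpa only [average_const] using abs_sub_average_le hint (integrable_const B) (hosc x hx)

lemma div_rpow_le_div_of_le_mul_rpow_inv {f : ℝ≥0∞} {A M T γ h : ℝ} (hT : 0 < T) (hM : 1 ≤ M)
    (hγ : 0 < γ) (hγA : γ⁻¹ ≤ A) (hh : 0 ≤ h) (hf : f ≤ ENNReal.ofReal (T * h ^ γ⁻¹)) :
    (f / ENNReal.ofReal (T * M ^ A)) ^ γ ≤ ENNReal.ofReal (h / M) := by
  have hM₀ : 0 < M := zero_lt_one.trans_le hM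
  calc (f / ENNReal.ofReal (T * M ^ A)) ^ γ
      ≤ ENNReal.ofReal (T * h ^ γ⁻¹ / (T * M ^ A)) ^ γ := by
        rw [ENNReal.ofReal_div_of_pos (by positivity)]
        gcongr
    _ = ENNReal.ofReal (h / M ^ (A * γ)) := by
        rw [mul_div_mul_left _ _ hT.ne', ENNReal.ofReal_rpow_of_nonneg (by positivity) hγ.le,
          Real.div_rpow (by positivity) (by positivity), ← Real.rpow_mul hh,
          ← Real.rpow_mul hM₀.le, inv_mul_cancel₀ hγ.ne', Real.rpow_one]
    _ ≤ ENNReal.ofReal (h / M) := by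
        gcongr
        exact Real.self_le_rpow_of_one_le hM ((inv_le_iff_one_le_mul₀ hγ).1 hγA)

lemma lpNorm_le_of_ae_le_mul_rpow {γ F : X → ℝ} {A M T : ℝ} {f : X → ℝ≥0∞} (hT : 0 < T)
    (hM : 1 ≤ M) (hγ : ∀ x, 0 < γ x) (hγA : ∀ x, (γ x)⁻¹ ≤ A) (hF₀ : ∀ x, 0 ≤ F x)
    (hF : Integrable F μ) (hFM : ∫ x, F x ∂μ ≤ M)
    (hf : ∀ᵐ x ∂μ, f x ≤ ENNReal.ofReal (T * F x ^ (γ x)⁻¹)) :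
    lpNorm μ γ f ≤ ENNReal.ofReal (T * M ^ A) := by
  have hM₀ : 0 < M := zero_lt_one.trans_le hM
  refine sInf_le ⟨ENNReal.ofReal_pos.2 (by positivity), ENNReal.ofReal_lt_top, ?_⟩
  calc modular μ γ (fun x => f x / ENNReal.ofReal (T * M ^ A))
      ≤ ∫⁻ x, ENNReal.ofReal (F x / M) ∂μ := lintegral_mono_ae (hf.mono fun x hx =>
        div_rpow_le_div_of_le_mul_rpow_inv hT hM (hγ x) (hγA x) (hF₀ x) hx)
    _ = ENNReal.ofReal ((∫ x, F x ∂μ) / M) := by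
        rw [← integral_div, ofReal_integral_eq_lintegral_ofReal (hF.div_const M)
          (.of_forall fun x => div_nonneg (hF₀ x) hM₀.le)]
    _ ≤ 1 := ENNReal.ofReal_le_one.2 ((div_le_one hM₀).2 hFM)

section Exponential

variable {w F : X → ℝ} {a C M : ℝ}

lemma ae_abs_sub_le_mul_one_add (hC : 0 < C) (hF₀ : ∀ x, 0 ≤ F x)
    (h : ∀ᵐ x ∂μ, |w x - a| ≤ C * (1 + Real.log (1 + F x))) :
    ∀ᵐ x ∂μ, |w x - a| ≤ C * (1 + F x) := by
  filter_upwards [h] with x hx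
  refine hx.trans ?_
  gcongr
  linarith [Real.log_le_sub_one_of_pos (add_pos_of_pos_of_nonneg one_pos (hF₀ x))]

variable [IsFiniteMeasure μ] [NeZero μ]

lemma average_one_add (hF : Integrable F μ) : ⨍ x, (1 + F x) ∂μ = 1 + ⨍ x, F x ∂μ := by
  conv_rhs => rw [← average_const μ (1 : ℝ)]
  exact integral_add (integrable_const 1) hF.to_average

lemma exp_inv_mul_abs_sub_average_le (hC : 0 < C) (hw : Integrable w μ) (hF₀ : ∀ x, 0 ≤ F x)
    (hF : Integrable F μ) (hFM : ⨍ x, F x ∂μ ≤ M)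
    (h : ∀ᵐ x ∂μ, |w x - a| ≤ C * (1 + Real.log (1 + F x))) :
    ∀ᵐ x ∂μ, Real.exp (C⁻¹ * |w x - ⨍ y, w y ∂μ|) ≤ Real.exp (2 + M) * (1 + F x) := by
  have hmean : |a - ⨍ y, w y ∂μ| ≤ C * (1 + M) := by
    refine (abs_sub_average_le hw (((integrable_const 1).add hF).const_mul C)
      (ae_abs_sub_le_mul_one_add hC hF₀ h)).trans ?_
    calc ⨍ x, C * (1 + F x) ∂μ = C * (1 + ⨍ x, F x ∂μ) := by
          rw [← average_one_add hF]
          exact integral_const_mul _ _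
      _ ≤ C * (1 + M) := by gcongr
  filter_upwards [h] with x hx
  have hF_pos : 0 < 1 + F x := add_pos_of_pos_of_nonneg one_pos (hF₀ x)
  calc Real.exp (C⁻¹ * |w x - ⨍ y, w y ∂μ|)
      ≤ Real.exp (C⁻¹ * (C * (1 + Real.log (1 + F x)) + C * (1 + M))) := by
        gcongr
        exact (abs_sub_le _ a _).trans (add_le_add hx hmean)
    _ = Real.exp (2 + M + Real.log (1 + F x)) := by
        congr 1
        field_simp
        ring
    _ = Real.exp (2 + M) * (1 + F x) := by rw [Real.exp_add, Real.exp_log hF_pos]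

lemma laverage_exp_abs_sub_average_le (hC : 0 < C) (hw : Integrable w μ) (hF₀ : ∀ x, 0 ≤ F x)
    (hF : Integrable F μ) (hFM : ⨍ x, F x ∂μ ≤ M)
    (h : ∀ᵐ x ∂μ, |w x - a| ≤ C * (1 + Real.log (1 + F x))) :
    ⨍⁻ x, ENNReal.ofReal (Real.exp (C⁻¹ * |w x - ⨍ y, w y ∂μ|)) ∂μ ≤
      ENNReal.ofReal (Real.exp (2 + M) * (1 + M)) := by
  have hint : Integrable (fun x => Real.exp (2 + M) * (1 + F x)) μ :=
    ((integrable_const 1).add hF).const_mul _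
  calc ⨍⁻ x, ENNReal.ofReal (Real.exp (C⁻¹ * |w x - ⨍ y, w y ∂μ|)) ∂μ
      ≤ ⨍⁻ x, ENNReal.ofReal (Real.exp (2 + M) * (1 + F x)) ∂μ :=
        laverage_mono_ae ((exp_inv_mul_abs_sub_average_le hC hw hF₀ hF hFM h).mono
          fun x hx => ENNReal.ofReal_le_ofReal hx)
    _ = ENNReal.ofReal (Real.exp (2 + M) * (1 + ⨍ x, F x ∂μ)) := by
        rw [laverage_eq, ← ofReal_average hint (.of_forall fun x =>
          mul_nonneg (Real.exp_pos _).le (add_nonneg zero_le_one (hF₀ x))), ← average_one_add hF]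
        congr 1
        exact integral_const_mul _ _
    _ ≤ ENNReal.ofReal (Real.exp (2 + M) * (1 + M)) := by gcongr

end Exponential

end Integration

section HolderExtension

variable {Y : Type*} [MetricSpace Y] {S : Set Y} {U α : Y → ℝ} {α₀ L : ℝ}

lemma uniformContinuous_of_abs_sub_le_dist_rpow (hα₀ : 0 < α₀) (hα : ∀ x, α₀ ≤ α x)
    (h : ∀ x ∈ S, ∀ y ∈ S, |U x - U y| ≤ L * dist x y ^ α x) :
    UniformContinuous (S.domRestrict U) := by
  rw [Metric.uniformContinuous_iff]
  intro ε hε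
  have hlim : Filter.Tendsto (fun r : ℝ => |L| * r ^ α₀) (nhds 0) (nhds 0) := by
    simpa [Real.zero_rpow hα₀.ne'] using
      ((Real.continuous_rpow_const hα₀.le).tendsto 0).const_mul |L|
  obtain ⟨η, hη, hηε⟩ := Metric.eventually_nhds_iff.1 (hlim.eventually_lt_const hε)
  refine ⟨min η 1, by positivity, fun a b hab => ?_⟩
  obtain ⟨hdη, hd1⟩ := lt_min_iff.1 hab
  calc |U a - U b| ≤ L * dist (a : Y) b ^ α a := h a a.2 b b.2
    _ ≤ |L| * dist (a : Y) b ^ α a := by gcongr; exact le_abs_self L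
    _ ≤ |L| * dist (a : Y) b ^ α₀ := by
      gcongr ?_ * ?_
      exact Real.rpow_le_rpow_of_exponent_ge' dist_nonneg hd1.le hα₀.le (hα a)
    _ < ε := hηε (by rwa [Real.dist_eq, sub_zero, abs_of_nonneg dist_nonneg])

lemma abs_sub_le_dist_rpow_of_dense (hS : Dense S) (hU : Continuous U) (hα : Continuous α)
    (hα_pos : ∀ x, 0 < α x) (h : ∀ x ∈ S, ∀ y ∈ S, |U x - U y| ≤ L * dist x y ^ α x) (x y : Y) :
    |U x - U y| ≤ L * dist x y ^ α x := by
  have hclosed : IsClosed {z : Y × Y | |U z.1 - U z.2| ≤ L * dist z.1 z.2 ^ α z.1} :=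
    isClosed_le (by fun_prop) (continuous_const.mul (Continuous.rpow (by fun_prop)
      (by fun_prop) fun z => Or.inr (hα_pos _)))
  have hsub : S ×ˢ S ⊆ {z : Y × Y | |U z.1 - U z.2| ≤ L * dist z.1 z.2 ^ α z.1} :=
    fun z hz => h z.1 hz.1 z.2 hz.2
  have huniv := closure_minimal hsub hclosed
  rw [(hS.prod hS).closure_eq] at huniv
  exact huniv (mem_univ (x, y))

lemma exists_continuous_eqOn_abs_sub_le (hS : Dense S) (hα_cont : Continuous α) (hα₀ : 0 < α₀)
    (hα : ∀ x, α₀ ≤ α x) (h : ∀ x ∈ S, ∀ y ∈ S, |U x - U y| ≤ L * dist x y ^ α x) :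
    ∃ v : Y → ℝ, Continuous v ∧ EqOn v U S ∧ ∀ x y, |v x - v y| ≤ L * dist x y ^ α x := by
  have hUC := uniformContinuous_of_abs_sub_le_dist_rpow hα₀ hα h
  have hind := isUniformInducing_val S
  have hv := (uniformContinuous_uniformly_extend hind hS.denseRange_val hUC).continuous
  have hvU : EqOn ((hind.isDenseInducing hS.denseRange_val).extend (S.domRestrict U)) U S :=
    fun x hx => uniformly_extend_of_ind hind hS.denseRange_val hUC ⟨x, hx⟩
  refine ⟨_, hv, hvU, abs_sub_le_dist_rpow_of_dense hS hv hα_cont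
    (fun x => hα₀.trans_le (hα x)) fun x hx y hy => ?_⟩
  rw [hvU hx, hvU hy]
  exact h x hx y hy

end HolderExtension

section Exponents

variable {X : Type*} [MetricSpace X] {P s R Q p : X → ℝ} {Λ β₀ : ℝ}

lemma sobolevExponent_eq_inv_gap {p s Q : ℝ} (hp : p ≠ 0) (hQ : Q ≠ 0) :
    Q * p / (Q - s * p) = (p⁻¹ - s * Q⁻¹)⁻¹ := by
  rw [← inv_div]
  congr 1
  field_simp

lemma sub_div_eq_neg_gap_mul {p s Q : ℝ} (hQ : Q ≠ 0) :
    s - Q / p = -(p⁻¹ - s * Q⁻¹) * Q := by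
  field_simp
  ring

namespace ReciprocalExponents

lemma mul_inv_le_mul_mul (h : ReciprocalExponents Λ P s R) {a c : ℝ} (ha : 0 ≤ a) (hac : a ≤ c)
    (x : X) : a * (Λ⁻¹ * Λ⁻¹) ≤ c * (P x * R x) := by
  have hΛ := h.pos
  have hP := (h.P_pos x).le
  gcongr
  exacts [ha.trans hac, (h.P_mem x).1, (h.R_mem x).1]

lemma mul_inv_le_sub_div (h : ReciprocalExponents Λ (fun x => (p x)⁻¹) s (fun x => (Q x)⁻¹))
    (h₀ : 0 < β₀) (hβ : ∀ x, (p x)⁻¹ - s x * (Q x)⁻¹ ≤ -β₀) (x : X) :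
    β₀ * Λ⁻¹ ≤ s x - Q x / p x := by
  have hQ : 0 < Q x := inv_pos.1 (h.R_pos x)
  rw [sub_div_eq_neg_gap_mul hQ.ne']
  have hΛ := h.pos
  have hgap := le_neg_of_le_neg (hβ x)
  gcongr
  exacts [h₀.le.trans hgap, inv_le_of_inv_le₀ hQ (h.R_mem x).2]

lemma sub_div_le (h : ReciprocalExponents Λ (fun x => (p x)⁻¹) s (fun x => (Q x)⁻¹)) (x : X) :
    s x - Q x / p x ≤ Λ :=
  (sub_le_self _ (div_pos (inv_pos.1 (h.R_pos x)) (inv_pos.1 (h.P_pos x))).le).trans (h.s_mem x).2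

end ReciprocalExponents

variable [MeasurableSpace X] {μ : Measure X} {b δ : ℝ}

lemma Setting.exists_le_gap (h : Setting μ b δ Q p s) (hsp : MuchLess μ (fun x => s x * p x) Q) :
    ∃ β₀ : ℝ, 0 < β₀ ∧ ∀ x, β₀ ≤ (p x)⁻¹ - s x * (Q x)⁻¹ := by
  obtain ⟨Λ, hΛ⟩ := h.exists_reciprocalExponents
  obtain ⟨a, ha, hle⟩ := hsp.exists_forall h.metricMeasure
    (h.s_log.continuous.mul h.p_log.continuous) h.Q_log.continuous
  have := hΛ.pos
  refine ⟨a * (Λ⁻¹ * Λ⁻¹), by positivity, fun x => ?_⟩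
  have hp := (h.p_log.bdd.pos x).ne'
  have hQ := (h.Q_log.bdd.pos x).ne'
  calc a * (Λ⁻¹ * Λ⁻¹) ≤ (Q x - s x * p x) * ((p x)⁻¹ * (Q x)⁻¹) :=
        hΛ.mul_inv_le_mul_mul ha.le (hle x) x
    _ = (p x)⁻¹ - s x * (Q x)⁻¹ := by field_simp

lemma Setting.exists_gap_le_neg (h : Setting μ b δ Q p s)
    (hsp : MuchLess μ Q (fun x => s x * p x)) :
    ∃ β₀ : ℝ, 0 < β₀ ∧ ∀ x, (p x)⁻¹ - s x * (Q x)⁻¹ ≤ -β₀ := by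
  obtain ⟨Λ, hΛ⟩ := h.exists_reciprocalExponents
  obtain ⟨a, ha, hle⟩ := hsp.exists_forall h.metricMeasure h.Q_log.continuous
    (h.s_log.continuous.mul h.p_log.continuous)
  have := hΛ.pos
  refine ⟨a * (Λ⁻¹ * Λ⁻¹), by positivity, fun x => le_neg_of_le_neg ?_⟩
  have hp := (h.p_log.bdd.pos x).ne'
  have hQ := (h.Q_log.bdd.pos x).ne'
  calc a * (Λ⁻¹ * Λ⁻¹) ≤ (s x * p x - Q x) * ((p x)⁻¹ * (Q x)⁻¹) :=
        hΛ.mul_inv_le_mul_mul ha.le (hle x) x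
    _ = -((p x)⁻¹ - s x * (Q x)⁻¹) := by field_simp; ring

end Exponents

section HajlaszSobolev

variable {X : Type*} [MetricSpace X] [MeasurableSpace X] {p s Q : X → ℝ} {Λ D b δ β₀ : ℝ}

lemma HasHajlaszPower.lpNorm_le {μ : Measure X} [IsFiniteMeasure μ] {N : Set X} {H : X → ℝ≥0∞}
    {w γ : X → ℝ} {f : X → ℝ≥0∞} {T : ℝ} (hw : HasHajlaszPower μ p s N H w) (hT : 0 < T)
    (hγ : ∀ x, 0 < γ x) (hγΛ : ∀ x, (γ x)⁻¹ ≤ Λ)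
    (hf : ∀ x ∉ N, f x ≤ ENNReal.ofReal (T * (1 + (H x).toReal) ^ (γ x)⁻¹)) :
    lpNorm μ γ f ≤ ENNReal.ofReal (T * (μ.real univ + 2) ^ Λ) := by
  have hmass : ∫ x, (1 + (H x).toReal) ∂μ ≤ μ.real univ + 2 := by
    rw [integral_add (integrable_const 1) hw.integrable, integral_const, smul_eq_mul, mul_one]
    gcongr
    exact hw.integral_le
  exact lpNorm_le_of_ae_le_mul_rpow hT (by linarith [measureReal_nonneg (μ := μ) (s := univ)])
    hγ hγΛ (fun x => add_nonneg zero_le_one ENNReal.toReal_nonneg)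
    ((integrable_const 1).add hw.integrable) hmass (hw.ae_notMem.mono hf)

lemma LowerMeasureBound.inv_measureReal_univ_le {μ : Measure X} [IsFiniteMeasure μ]
    (hμ : LowerMeasureBound μ b δ Q) (hb : 0 < b) (hδ : 0 < δ) (x : X) :
    (μ.real univ)⁻¹ ≤ (b * δ ^ Q x)⁻¹ := by
  have hball : b * δ ^ Q x ≤ μ.real univ := by
    rw [measureReal_def, ← ENNReal.ofReal_le_iff_le_toReal (measure_ne_top μ univ)]
    exact (hμ x δ hδ le_rfl).trans (measure_mono (subset_univ _))
  gcongr

lemma LowerMeasureBound.neZero {μ : Measure X} (hμ : LowerMeasureBound μ b δ Q) (hb : 0 < b)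
    (hδ : 0 < δ) (x : X) : NeZero μ := by
  refine ⟨fun h => ?_⟩
  have hball := hμ x δ hδ le_rfl
  rw [h, Measure.coe_zero, Pi.zero_apply, nonpos_iff_eq_zero, ENNReal.ofReal_eq_zero] at hball
  exact hball.not_gt (by positivity)

namespace ReciprocalExponents

lemma exists_iInf_lpNorm_sub_le [Nonempty X]
    (h : ReciprocalExponents Λ (fun x => (p x)⁻¹) s (fun x => (Q x)⁻¹)) (hp : Measurable p)
    (hD : ∀ x y : X, dist x y ≤ D) (hb : 0 < b) (hδ : 0 < δ) (h₀ : 0 < β₀)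
    (hβ : ∀ x, β₀ ≤ (p x)⁻¹ - s x * (Q x)⁻¹) (m : ℝ) (hm : 0 ≤ m) :
    ∃ C : ℝ, 0 < C ∧ ∀ (μ : Measure X) [IsFiniteMeasure μ], LowerMeasureBound μ b δ Q →
      μ.real univ = m → ∀ (w : X → ℝ) (G : X → ℝ≥0∞), IsHajlaszGradient μ s w G →
      ⨅ c : ℝ, lpNorm μ (fun x => ((p x)⁻¹ - s x * (Q x)⁻¹)⁻¹)
        (fun x => ENNReal.ofReal |w x - c|) ≤ ENNReal.ofReal C * lpNorm μ p G := by
  obtain ⟨C, hC, hpoint⟩ := h.exists_abs_sub_le_rpow hD hb hδ h₀ hβ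
  have : 0 < C := one_pos.trans_le hC
  have hK : 0 < C * (m + 2) ^ Λ := by positivity
  refine ⟨C * (m + 2) ^ Λ, hK, ?_⟩
  rintro μ _ hμ rfl w G hG
  refine le_mul_of_forall_lt hK fun t ht hGt => ?_
  obtain ⟨N, H, hw, -⟩ := hG.exists_hasHajlaszPower (fun x => inv_pos.1 (h.P_pos x)) hp ht hGt
    measurable_zero (by simp)
  obtain ⟨z, -, -, hz⟩ := hpoint μ hμ N H _ hw
  rw [mul_right_comm]
  refine iInf_le_of_le (w z) (hw.lpNorm_le (by positivity)
    (fun x => inv_pos.2 (h₀.trans_le (hβ x))) (fun x => by rw [inv_inv]; exact h.gap_le x)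
    fun x hx => ENNReal.ofReal_le_ofReal ?_)
  have hosc := hz x hx
  rw [← sub_div, abs_div, abs_of_pos ht, div_le_iff₀ ht] at hosc
  rwa [inv_inv, mul_right_comm]

lemma exists_lpNorm_le [Nonempty X]
    (h : ReciprocalExponents Λ (fun x => (p x)⁻¹) s (fun x => (Q x)⁻¹)) (hp : Measurable p)
    (hD : ∀ x y : X, dist x y ≤ D) (hb : 0 < b) (hδ : 0 < δ) (h₀ : 0 < β₀)
    (hβ : ∀ x, β₀ ≤ (p x)⁻¹ - s x * (Q x)⁻¹) (m : ℝ) (hm : 0 ≤ m) :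
    ∃ C : ℝ, 0 < C ∧ ∀ (μ : Measure X) [IsFiniteMeasure μ], LowerMeasureBound μ b δ Q →
      μ.real univ = m → ∀ (w : X → ℝ) (G : X → ℝ≥0∞), Measurable w → IsHajlaszGradient μ s w G →
      lpNorm μ (fun x => ((p x)⁻¹ - s x * (Q x)⁻¹)⁻¹) (fun x => ENNReal.ofReal |w x|) ≤
        ENNReal.ofReal C * (lpNorm μ p (fun x => ENNReal.ofReal |w x|) + lpNorm μ p G) := by
  obtain ⟨C, hC, hpoint⟩ := h.exists_abs_sub_le_rpow hD hb hδ h₀ hβ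
  have : 0 < C := one_pos.trans_le hC
  have hK : 0 < (C + C ^ Λ) * (m + 2) ^ Λ := by positivity
  refine ⟨(C + C ^ Λ) * (m + 2) ^ Λ, hK, ?_⟩
  rintro μ _ hμ rfl w G hw_meas hG
  refine le_mul_of_forall_lt hK fun t ht hlt => ?_
  obtain ⟨N, H, hw, hwH⟩ := hG.exists_hasHajlaszPower_of_lpNorm_lt
    (fun x => inv_pos.1 (h.P_pos x)) hp hw_meas ht (le_add_self.trans_lt hlt)
    (le_self_add.trans_lt hlt)
  obtain ⟨z, hzN, hzC, hz⟩ := hpoint μ hμ N H _ hw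
  have hwz : |w z / t| ≤ C ^ Λ := (hwH z hzN).trans <|
    (Real.rpow_le_rpow ENNReal.toReal_nonneg hzC (h.P_pos z).le).trans
      (Real.rpow_le_rpow_of_exponent_le hC (h.P_mem z).2)
  rw [mul_right_comm]
  refine hw.lpNorm_le (by positivity) (fun x => inv_pos.2 (h₀.trans_le (hβ x)))
    (fun x => by rw [inv_inv]; exact h.gap_le x) fun x hx => ENNReal.ofReal_le_ofReal ?_
  have habs : |w x| / t = |w x / t| := by rw [abs_div, abs_of_pos ht]
  rw [inv_inv, mul_right_comm, ← div_le_iff₀ ht, habs]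
  have hpow : 1 ≤ (1 + (H x).toReal) ^ ((p x)⁻¹ - s x * (Q x)⁻¹) :=
    Real.one_le_rpow (le_add_of_nonneg_right ENNReal.toReal_nonneg) (h₀.le.trans (hβ x))
  calc |w x / t| ≤ |w x / t - w z / t| + |w z / t| :=
        sub_le_iff_le_add.1 (abs_sub_abs_le_abs_sub _ _)
    _ ≤ C * (1 + (H x).toReal) ^ ((p x)⁻¹ - s x * (Q x)⁻¹) +
        C ^ Λ * (1 + (H x).toReal) ^ ((p x)⁻¹ - s x * (Q x)⁻¹) :=
        add_le_add (hz x hx) (hwz.trans (le_mul_of_one_le_right (by positivity) hpow))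
    _ = (C + C ^ Λ) * (1 + (H x).toReal) ^ ((p x)⁻¹ - s x * (Q x)⁻¹) := (add_mul _ _ _).symm

lemma exists_laverage_exp_le [Nonempty X]
    (h : ReciprocalExponents Λ (fun x => (p x)⁻¹) s (fun x => (Q x)⁻¹)) (hp : Measurable p)
    (hD : ∀ x y : X, dist x y ≤ D) (hb : 0 < b) (hδ : 0 < δ)
    (hβ : ∀ x, (p x)⁻¹ - s x * (Q x)⁻¹ = 0) :
    ∃ C₁ C₂ : ℝ, 0 < C₁ ∧ 0 < C₂ ∧ ∀ (μ : Measure X) [IsFiniteMeasure μ],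
      LowerMeasureBound μ b δ Q → ∀ (w : X → ℝ) (G : X → ℝ≥0∞) (n : ℝ), Measurable w →
      IsHajlaszGradient μ s w G → 0 < n → lpNorm μ p G ≤ ENNReal.ofReal n →
      Integrable w μ ∧
      ⨍⁻ x, ENNReal.ofReal (Real.exp (C₁ * (|w x - ⨍ y, w y ∂μ| / n))) ∂μ ≤ ENNReal.ofReal C₂ := by
  obtain ⟨C, hC, hpoint⟩ := h.exists_abs_sub_le_log hD hb hδ hβ
  obtain ⟨x₀⟩ := ‹Nonempty X›
  set κ : ℝ := (b * δ ^ Q x₀)⁻¹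
  have hκ : 0 < κ := by positivity
  refine ⟨C⁻¹ / 2, Real.exp (2 + κ * 2) * (1 + κ * 2), by positivity, by positivity, ?_⟩
  intro μ _ hμ w G n hw_meas hG hn hGn
  have := hμ.neZero hb hδ x₀
  have hGt : lpNorm μ p G < ENNReal.ofReal (2 * n) :=
    hGn.trans_lt ((ENNReal.ofReal_lt_ofReal_iff (by positivity)).2 (by linarith))
  obtain ⟨N, H, hw, -⟩ := hG.exists_hasHajlaszPower (fun x => inv_pos.1 (h.P_pos x)) hp
    (by positivity) hGt measurable_zero (by simp)
  obtain ⟨z, hz⟩ := hpoint μ hμ N H _ hw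
  have hlog := hw.ae_notMem.mono hz
  have hH₀ : ∀ x, 0 ≤ (H x).toReal := fun x => ENNReal.toReal_nonneg
  have hint : Integrable (fun x => w x / (2 * n)) μ :=
    integrable_of_abs_sub_le (hw_meas.div_const _)
      (((integrable_const 1).add hw.integrable).const_mul C)
      (ae_abs_sub_le_mul_one_add hC hH₀ hlog)
  have hH_mean : ⨍ x, (H x).toReal ∂μ ≤ κ * 2 := by
    rw [average_eq, smul_eq_mul]
    exact mul_le_mul (hμ.inv_measureReal_univ_le hb hδ x₀) hw.integral_le
      (integral_nonneg hH₀) hκ.le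
  have hscale : ∀ x, C⁻¹ / 2 * (|w x - ⨍ y, w y ∂μ| / n) =
      C⁻¹ * |w x / (2 * n) - ⨍ y, w y / (2 * n) ∂μ| := fun x => by
    have hmean : ⨍ y, w y / (2 * n) ∂μ = (⨍ y, w y ∂μ) / (2 * n) := integral_div _ _
    rw [hmean, ← sub_div, abs_div, abs_of_pos (mul_pos two_pos hn)]
    field_simp
  refine ⟨by simpa [hn.ne'] using hint.mul_const (2 * n), ?_⟩
  simp only [hscale]
  exact laverage_exp_abs_sub_average_le hC hint hH₀ hw.integrable hH_mean hlog

lemma exists_null_abs_sub_le_dist_rpow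
    (h : ReciprocalExponents Λ (fun x => (p x)⁻¹) s (fun x => (Q x)⁻¹)) (hp : Measurable p)
    (hD : ∀ x y : X, dist x y ≤ D) (hb : 0 < b) (hδ : 0 < δ) (h₀ : 0 < β₀)
    (hβ : ∀ x, (p x)⁻¹ - s x * (Q x)⁻¹ ≤ -β₀) :
    ∃ C : ℝ, 0 < C ∧ ∀ μ : Measure X, LowerMeasureBound μ b δ Q →
      ∀ (w : X → ℝ) (G : X → ℝ≥0∞) (n : ℝ), IsHajlaszGradient μ s w G → 0 ≤ n →
      lpNorm μ p G ≤ ENNReal.ofReal n → ∃ N : Set X, μ N = 0 ∧ ∀ x ∉ N, ∀ y ∉ N,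
        |w x - w y| ≤ C * n * dist x y ^ (s x - Q x / p x) := by
  obtain ⟨C, hC, hpoint⟩ := h.exists_abs_sub_le_dist_rpow hD hb hδ h₀ hβ
  refine ⟨C, hC, fun μ hμ w G n hG hn hGn => ?_⟩
  simp only [mul_comm C, mul_assoc n]
  refine exists_null_forall_le_of_forall_lt fun t hnt => ?_
  have ht : 0 < t := hn.trans_lt hnt
  obtain ⟨N, H, hw, -⟩ := hG.exists_hasHajlaszPower (fun x => inv_pos.1 (h.P_pos x)) hp ht
    (hGn.trans_lt ((ENNReal.ofReal_lt_ofReal_iff ht).2 hnt)) measurable_zero (by simp)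
  refine ⟨N, hw.null, fun x hx y hy => ?_⟩
  have hosc := hpoint μ hμ N H _ hw x hx y hy
  rwa [← sub_div, abs_div, abs_of_pos ht, div_le_iff₀' ht, mul_comm C] at hosc

end ReciprocalExponents

lemma rpow_le_max_one_rpow {d α : ℝ} (hd : 0 ≤ d) (hdD : d ≤ D) (hα : 0 ≤ α) (hαΛ : α ≤ Λ) :
    d ^ α ≤ max 1 D ^ Λ :=
  (Real.rpow_le_rpow hd (hdD.trans (le_max_right 1 D)) hα).trans
    (Real.rpow_le_rpow_of_exponent_le (le_max_left 1 D) hαΛ)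

end HajlaszSobolev

section Embeddings

variable {X : Type*} [MetricSpace X] [MeasurableSpace X] {μ : Measure X} {b δ : ℝ} {Q p s : X → ℝ}
  {q : X → ℝ≥0∞} {A : Scale} {g : ℤ → X → ℝ≥0∞}

lemma Setting.mixedNorm_lt_top (h : Setting μ b δ Q p s) (hq : IsVarExponent μ q)
    (hg : MemMixed A μ p q g) : mixedNorm A μ p q g < ∞ := by
  obtain ⟨B, hB, hp⟩ := h.p_log.exists_forall_mem_Icc h.metricMeasure
  exact HajlaszEmbedding.mixedNorm_lt_top (inv_pos.2 (one_pos.trans_le hB)) (fun x => (hp x).1)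
    hq hg

variable [Nonempty X]

theorem sobolev_embedding (hX : Bornology.IsBounded (univ : Set X)) (hb : 0 < b) (hδ : 0 < δ)
    (m : ℝ≥0∞) : ∃ C : ℝ, 0 < C ∧ ∀ μ : Measure X,
      Setting μ b δ Q p s → μ univ = m → MuchLess μ (fun x => s x * p x) Q →
      ∀ (A : Scale) (q : X → ℝ≥0∞), AdmissibleExponent A μ p q →
        (∀ (u : X → EReal) (g : ℤ → X → ℝ≥0∞), MemHom A μ s p q u →
          IsVectorGradient μ s u g → MemMixed A μ p q g →
          ⨅ c : ℝ, lpNorm μ (fun x => Q x * p x / (Q x - s x * p x))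
              (fun x => (u x - (c : EReal)).abs)
            ≤ ENNReal.ofReal C * mixedNorm A μ p q g) ∧
        (∀ (u : X → EReal) (g : ℤ → X → ℝ≥0∞), MemInhom A μ s p q u →
          IsVectorGradient μ s u g → MemMixed A μ p q g →
          lpNorm μ (fun x => Q x * p x / (Q x - s x * p x)) (fun x => (u x).abs)
            ≤ ENNReal.ofReal C * (lpNorm μ p (fun x => (u x).abs) + mixedNorm A μ p q g)) := by
  by_cases hex : ∃ μ : Measure X, Setting μ b δ Q p s ∧ MuchLess μ (fun x => s x * p x) Q
  swap
  · exact ⟨1, one_pos, fun μ h _ hsp => (hex ⟨μ, h, hsp⟩).elim⟩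
  obtain ⟨μ₀, h₀, hsp₀⟩ := hex
  obtain ⟨Λ, hΛ⟩ := h₀.exists_reciprocalExponents
  obtain ⟨β₀, hβ₀, hβ⟩ := h₀.exists_le_gap hsp₀
  obtain ⟨D, hD⟩ := Metric.isBounded_iff.1 hX
  have hp := h₀.p_log.bdd.pos
  have hp_meas := h₀.p_log.bdd.measurable
  obtain ⟨C, hC, hhom⟩ := hΛ.exists_iInf_lpNorm_sub_le hp_meas
    (fun x y => hD (mem_univ x) (mem_univ y)) hb hδ hβ₀ hβ m.toReal ENNReal.toReal_nonneg
  obtain ⟨C', -, hinhom⟩ := hΛ.exists_lpNorm_le hp_meas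
    (fun x y => hD (mem_univ x) (mem_univ y)) hb hδ hβ₀ hβ m.toReal ENNReal.toReal_nonneg
  refine ⟨max C C', lt_max_of_lt_left hC, ?_⟩
  rintro μ h rfl - A q hq
  have : IsFiniteMeasure μ := ⟨h.metricMeasure.univ_lt_top hX⟩
  simp only [sobolevExponent_eq_inv_gap (hp _).ne' (h₀.Q_log.bdd.pos _).ne']
  refine ⟨fun u g hu hg _ => ?_, fun u g hu hg _ => ?_⟩
  · simp only [lpNorm_abs_sub_coe hu.ae_finite]
    refine (hhom μ h.lower rfl _ _ (hg.isHajlaszGradient_iSup hu.ae_finite)).trans ?_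
    gcongr
    exacts [le_max_left _ _, lpNorm_iSup_le_mixedNorm hp hp_meas hq hg.1]
  · have hu_fin := hu.memHom.ae_finite
    simp only [lpNorm_abs_toReal hu_fin]
    refine (hinhom μ h.lower rfl _ _ hu.memHom.measurable.ereal_toReal
      (hg.isHajlaszGradient_iSup hu_fin)).trans ?_
    gcongr
    exacts [le_max_right _ _, lpNorm_iSup_le_mixedNorm hp hp_meas hq hg.1]

theorem moser_trudinger (hX : Bornology.IsBounded (univ : Set X)) (hb : 0 < b) (hδ : 0 < δ) :
    ∃ C₁ C₂ : ℝ, 0 < C₁ ∧ 0 < C₂ ∧ ∀ μ : Measure X,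
      Setting μ b δ Q p s → (∀ x, s x * p x = Q x) →
      ∀ (A : Scale) (q : X → ℝ≥0∞), AdmissibleExponent A μ p q →
        ∀ (u : X → EReal) (g : ℤ → X → ℝ≥0∞), MemHom A μ s p q u →
          IsVectorGradient μ s u g → MemMixed A μ p q g → 0 < mixedNorm A μ p q g →
          Integrable (fun x => (u x).toReal) μ ∧
          ⨍⁻ x, ENNReal.ofReal (Real.exp (C₁ * (|(u x).toReal - mean μ u|
              / (mixedNorm A μ p q g).toReal))) ∂μ ≤ ENNReal.ofReal C₂ := by
  by_cases hex : ∃ μ : Measure X, Setting μ b δ Q p s ∧ ∀ x, s x * p x = Q x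
  swap
  · exact ⟨1, 1, one_pos, one_pos, fun μ h hsp => (hex ⟨μ, h, hsp⟩).elim⟩
  obtain ⟨μ₀, h₀, hsp⟩ := hex
  obtain ⟨Λ, hΛ⟩ := h₀.exists_reciprocalExponents
  obtain ⟨D, hD⟩ := Metric.isBounded_iff.1 hX
  have hp := h₀.p_log.bdd.pos
  have hp_meas := h₀.p_log.bdd.measurable
  have hβ : ∀ x, (p x)⁻¹ - s x * (Q x)⁻¹ = 0 := fun x => by
    have hpx := (hp x).ne'
    have hsx := (h₀.s_log.bdd.pos x).ne'
    rw [← hsp x]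
    field_simp
    ring
  obtain ⟨C₁, C₂, hC₁, hC₂, hexp⟩ := hΛ.exists_laverage_exp_le hp_meas
    (fun x y => hD (mem_univ x) (mem_univ y)) hb hδ hβ
  refine ⟨C₁, C₂, hC₁, hC₂, fun μ h _ A q hq u g hu hg hg_mem hg₀ => ?_⟩
  have : IsFiniteMeasure μ := ⟨h.metricMeasure.univ_lt_top hX⟩
  have hg_fin := (h.mixedNorm_lt_top hq.1 hg_mem).ne
  refine hexp μ h.lower _ _ _ hu.measurable.ereal_toReal (hg.isHajlaszGradient_iSup hu.ae_finite)
    (ENNReal.toReal_pos hg₀.ne' hg_fin) ?_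
  rw [ENNReal.ofReal_toReal hg_fin]
  exact lpNorm_iSup_le_mixedNorm hp hp_meas hq hg.1

theorem morrey_embedding (hX : Bornology.IsBounded (univ : Set X)) (hb : 0 < b) (hδ : 0 < δ) :
    ∃ C D : ℝ, 0 < C ∧ 0 < D ∧ ∀ μ : Measure X,
      Setting μ b δ Q p s → MuchLess μ Q (fun x => s x * p x) →
      ∀ (A : Scale) (q : X → ℝ≥0∞), AdmissibleExponent A μ p q →
        ∀ (u : X → EReal) (g : ℤ → X → ℝ≥0∞), MemHom A μ s p q u →
          IsVectorGradient μ s u g → MemMixed A μ p q g →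
          Integrable (fun x => (u x).toReal) μ ∧
          essSup (fun x => (u x - (mean μ u : EReal)).abs) μ
            ≤ ENNReal.ofReal C * mixedNorm A μ p q g ∧
          ∃ v : X → ℝ, Continuous v ∧ (∀ᵐ x ∂μ, u x = (v x : EReal)) ∧
            ∀ x y : X, |v x - v y| ≤ D * (mixedNorm A μ p q g).toReal
              * dist x y ^ (s x - Q x / p x) := by
  by_cases hex : ∃ μ : Measure X, Setting μ b δ Q p s ∧ MuchLess μ Q (fun x => s x * p x)
  swap
  · exact ⟨1, 1, one_pos, one_pos, fun μ h hsp => (hex ⟨μ, h, hsp⟩).elim⟩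
  obtain ⟨μ₀, h₀, hsp₀⟩ := hex
  obtain ⟨Λ, hΛ⟩ := h₀.exists_reciprocalExponents
  obtain ⟨β₀, hβ₀, hβ⟩ := h₀.exists_gap_le_neg hsp₀
  obtain ⟨d, hd⟩ := Metric.isBounded_iff.1 hX
  have hp := h₀.p_log.bdd.pos
  have hp_meas := h₀.p_log.bdd.measurable
  have hα := hΛ.mul_inv_le_sub_div hβ₀ hβ
  have hα₀ : 0 < β₀ * Λ⁻¹ := mul_pos hβ₀ (inv_pos.2 hΛ.pos)
  have hα_cont : Continuous fun x => s x - Q x / p x :=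
    h₀.s_log.continuous.sub (h₀.Q_log.continuous.div h₀.p_log.continuous fun x => (hp x).ne')
  have hdist : ∀ x y, dist x y ^ (s x - Q x / p x) ≤ max 1 d ^ Λ := fun x y =>
    rpow_le_max_one_rpow dist_nonneg (hd (mem_univ x) (mem_univ y)) (hα₀.le.trans (hα x))
      (hΛ.sub_div_le x)
  obtain ⟨C, hC, hholder⟩ := hΛ.exists_null_abs_sub_le_dist_rpow hp_meas
    (fun x y => hd (mem_univ x) (mem_univ y)) hb hδ hβ₀ hβ
  refine ⟨C * max 1 d ^ Λ, C, by positivity, hC, fun μ h _ A q hq u g hu hg hg_mem => ?_⟩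
  have : IsFiniteMeasure μ := ⟨h.metricMeasure.univ_lt_top hX⟩
  have := h.metricMeasure.isOpenPosMeasure
  have := h.lower.neZero hb hδ (Classical.arbitrary X)
  have hg_fin := (h.mixedNorm_lt_top hq.1 hg_mem).ne
  obtain ⟨N, hN, hw⟩ := hholder μ h.lower _ _ _ (hg.isHajlaszGradient_iSup hu.ae_finite)
    ENNReal.toReal_nonneg ((lpNorm_iSup_le_mixedNorm hp hp_meas hq hg.1).trans
      (ENNReal.ofReal_toReal hg_fin).ge)
  have hae : ∀ᵐ x ∂μ, x ∉ N := measure_eq_zero_iff_ae_notMem.1 hN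
  obtain ⟨hint, hmean⟩ := integrable_and_ae_abs_sub_average_le hu.measurable.ereal_toReal hN
    fun x hx y hy => (hw x hx y hy).trans (mul_le_mul_of_nonneg_left (hdist x y) (by positivity))
  obtain ⟨v, hv, hvu, hv_holder⟩ :=
    exists_continuous_eqOn_abs_sub_le (Measure.dense_of_ae hae) hα_cont hα₀ hα hw
  refine ⟨hint, essSup_le_of_ae_le _ ?_, v, hv, ?_, hv_holder⟩
  · filter_upwards [hmean, hu.ae_finite] with x hx hux
    rw [ereal_abs_sub_of_finite hux (by simp), ← ENNReal.ofReal_toReal hg_fin,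
      ← ENNReal.ofReal_mul (by positivity), mul_right_comm]
    exact ENNReal.ofReal_le_ofReal hx
  · filter_upwards [hae, hu.ae_finite] with x hx hux
    rw [hvu hx, EReal.coe_toReal hux.1 hux.2]

end Embeddings

end HajlaszEmbedding

theorem mainTheorem10 {X : Type*} [MetricSpace X] [Nonempty X] [MeasurableSpace X] [BorelSpace X]
    (hX : Bornology.IsBounded (Set.univ : Set X))
    (b δ : ℝ) (hb : 0 < b) (hb1 : b ≤ 1) (hδ : 0 < δ) (Q p s : X → ℝ) :
    -- (i) Sobolev inequalities; the constant may depend on the total mass `m` of the measure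
    (∀ m : ℝ≥0∞, ∃ C : ℝ, 0 < C ∧ ∀ μ : Measure X,
      HajlaszEmbedding.Setting μ b δ Q p s → μ Set.univ = m →
      HajlaszEmbedding.MuchLess μ (fun x => s x * p x) Q →
      ∀ (A : HajlaszEmbedding.Scale) (q : X → ℝ≥0∞),
        HajlaszEmbedding.AdmissibleExponent A μ p q →
        (∀ (u : X → EReal) (g : ℤ → X → ℝ≥0∞), HajlaszEmbedding.MemHom A μ s p q u →
          HajlaszEmbedding.IsVectorGradient μ s u g → HajlaszEmbedding.MemMixed A μ p q g →
          ⨅ c : ℝ, HajlaszEmbedding.lpNorm μ (fun x => Q x * p x / (Q x - s x * p x))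
              (fun x => (u x - (c : EReal)).abs)
            ≤ ENNReal.ofReal C * HajlaszEmbedding.mixedNorm A μ p q g) ∧
        (∀ (u : X → EReal) (g : ℤ → X → ℝ≥0∞), HajlaszEmbedding.MemInhom A μ s p q u →
          HajlaszEmbedding.IsVectorGradient μ s u g → HajlaszEmbedding.MemMixed A μ p q g →
          HajlaszEmbedding.lpNorm μ (fun x => Q x * p x / (Q x - s x * p x))
              (fun x => (u x).abs)
            ≤ ENNReal.ofReal C * (HajlaszEmbedding.lpNorm μ p (fun x => (u x).abs)
                + HajlaszEmbedding.mixedNorm A μ p q g))) ∧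
    -- (ii) Moser–Trudinger inequality
    (∃ C₁ C₂ : ℝ, 0 < C₁ ∧ 0 < C₂ ∧ ∀ μ : Measure X,
      HajlaszEmbedding.Setting μ b δ Q p s → (∀ x, s x * p x = Q x) →
      ∀ (A : HajlaszEmbedding.Scale) (q : X → ℝ≥0∞),
        HajlaszEmbedding.AdmissibleExponent A μ p q →
        ∀ (u : X → EReal) (g : ℤ → X → ℝ≥0∞), HajlaszEmbedding.MemHom A μ s p q u →
          HajlaszEmbedding.IsVectorGradient μ s u g → HajlaszEmbedding.MemMixed A μ p q g →
          0 < HajlaszEmbedding.mixedNorm A μ p q g →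
          Integrable (fun x => (u x).toReal) μ ∧
          ⨍⁻ x, ENNReal.ofReal (Real.exp (C₁ * (|(u x).toReal - HajlaszEmbedding.mean μ u|
              / (HajlaszEmbedding.mixedNorm A μ p q g).toReal))) ∂μ ≤ ENNReal.ofReal C₂) ∧
    -- (iii) Morrey inequality and Hölder continuity
    (∃ C D : ℝ, 0 < C ∧ 0 < D ∧ ∀ μ : Measure X,
      HajlaszEmbedding.Setting μ b δ Q p s →
      HajlaszEmbedding.MuchLess μ Q (fun x => s x * p x) →
      ∀ (A : HajlaszEmbedding.Scale) (q : X → ℝ≥0∞),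
        HajlaszEmbedding.AdmissibleExponent A μ p q →
        ∀ (u : X → EReal) (g : ℤ → X → ℝ≥0∞), HajlaszEmbedding.MemHom A μ s p q u →
          HajlaszEmbedding.IsVectorGradient μ s u g → HajlaszEmbedding.MemMixed A μ p q g →
          Integrable (fun x => (u x).toReal) μ ∧
          essSup (fun x => (u x - (HajlaszEmbedding.mean μ u : EReal)).abs) μ
            ≤ ENNReal.ofReal C * HajlaszEmbedding.mixedNorm A μ p q g ∧
          ∃ v : X → ℝ, Continuous v ∧ (∀ᵐ x ∂μ, u x = (v x : EReal)) ∧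
            ∀ x y : X, |v x - v y| ≤ D * (HajlaszEmbedding.mixedNorm A μ p q g).toReal
              * dist x y ^ (s x - Q x / p x)) := by
  exact ⟨HajlaszEmbedding.sobolev_embedding hX hb hδ, HajlaszEmbedding.moser_trudinger hX hb hδ,
    HajlaszEmbedding.morrey_embedding hX hb hδ⟩
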